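/- Consider Turing machines with a two-way read-only input tape and finitely many read-write work tapes; on a given input, a machine uses space at most $s$ if in every computation at most $s$ cells of each work tape are visited. Let $\mathrm{L}$ (respectively $\mathrm{NL}$) be the class of all languages over finite alphabets that are decided by deterministic Turing machines (respectively recognized by nondeterministic Turing machines) using space at most $c\log|x|+d$ on every input $x$, for some constants $c,d\ge 0$; logarithms are to base $2$ and $\log 0=0$. A 2CNF formula is a conjunction of one or more clauses, each a disjunction of one or two literals; formulas are written as strings over a fixed finite alphabet, with variables named by binary strings. Let $\mathrm{2SAT}_3$ be the set of all satisfiable 2CNF formulas $\phi$ such that, for each variable $v$ of $\phi$, the total number of occurrences of $v$ and $\overline{v}$ in $\phi$ is at most $3$. Let $m_{vbl}(x)$ be the number of distinct variables of a formula $x$. A function $\ell:\mathbb{N}\to\mathbb{R}^{\ge 0}$ is polylogarithmic if there is a polynomial $p$ with nonnegative integer coefficients such that $\ell(n)=p(\log n)$ for all $n$. The Linear Space Hypothesis (LSH) for $\mathrm{2SAT}_3$ states: for every $\varepsilon\in(0,1)$ and every polylogarithmic function $\ell$, there is no deterministic Turing machine that decides $\mathrm{2SAT}_3$ in time polynomial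 in the length $|x|$ of its input $x$ and, simultaneously, uses space at most $m_{vbl}(x)^{\varepsilon}\,\ell(|x|)$ on every 2CNF formula $x$. **Theorem.** If LSH for $\mathrm{2SAT}_3$ is true, then $\mathrm{L}\neq\mathrm{NL}$. -/

import Mathlib

/-! ## Multi-tape Turing machines with a read-only input tape -/

namespace SpaceBounded

/-- Head movements. -/
inductive Move
  | left
  | stay
  | right

/-- Symbols on the input tape: the input `x` is stored between two end markers. -/
inductive InputSymbol (A : Type)
  | leftEnd
  | letter (a : A)
  | rightEnd

/-- What one transition does: new state, movement of the input head, and for each of the `k` work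
tapes the symbol written and the movement of the head. -/
structure Action (Q G : Type) (k : ℕ) where
  state : Q
  inputMove : Move
  write : Fin k → G
  move : Fin k → Move

/-- A (nondeterministic) Turing machine with a two-way read-only input tape over the alphabet `A`
and `k` one-way infinite read-write work tapes. Each situation (state, scanned input symbol,
scanned work symbols) allows a set of actions; the machine halts when there is none. -/
structure Machine (A : Type) where
  State : Type
  stateFinite : Finite State
  Work : Type
  workFinite : Finite Work
  blank : Work
  k : ℕ
  start : State
  accepting : Set State
  trans : State → InputSymbol A → (Fin k → Work) → Set (Action State Work k)

namespace Machine

variable {A : Type}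

/-- A machine is deterministic if every situation allows at most one action. -/
def Deterministic (M : Machine A) : Prop :=
  ∀ q a g, (M.trans q a g).Subsingleton

/-- Configurations. Input cells are numbered `0, …, |x| + 1` and work cells `0, 1, 2, …`. -/
structure Config (M : Machine A) where
  state : M.State
  inputPos : ℕ
  tape : Fin M.k → ℕ → M.Work
  pos : Fin M.k → ℕ

/-- The symbol in cell `p` of the input tape holding `x`. -/
def inputAt (x : List A) : ℕ → InputSymbol A
  | 0 => .leftEnd
  | p + 1 => (x[p]?).elim .rightEnd .letter

/-- The input head never leaves the cells `0, …, |x| + 1`. -/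
def moveInput (x : List A) (p : ℕ) : Move → ℕ
  | .left => p - 1
  | .stay => p
  | .right => min (p + 1) (x.length + 1)

/-- A work head that is told to move left from cell `0` stays there. -/
def moveWork (p : ℕ) : Move → ℕ
  | .left => p - 1
  | .stay => p
  | .right => p + 1

/-- The configuration after an action. -/
def apply (M : Machine A) (x : List A) (c : M.Config) (t : Action M.State M.Work M.k) :
    M.Config where
  state := t.state
  inputPos := moveInput x c.inputPos t.inputMove
  tape := fun i => Function.update (c.tape i) (c.pos i) (t.write i)
  pos := fun i => moveWork (c.pos i) (t.move i)

/-- The actions allowed in a configuration on input `x`. -/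
def actions (M : Machine A) (x : List A) (c : M.Config) : Set (Action M.State M.Work M.k) :=
  M.trans c.state (inputAt x c.inputPos) (fun i => c.tape i (c.pos i))

/-- The start configuration: all heads on cell `0`, all work tapes blank. -/
def startConfig (M : Machine A) : M.Config where
  state := M.start
  inputPos := 0
  tape := fun _ _ => M.blank
  pos := fun _ => 0

/-- `M.ReachesIn x n c`: some computation of `M` on `x` is in configuration `c` after exactly
`n` steps. -/
inductive ReachesIn (M : Machine A) (x : List A) : ℕ → M.Config → Prop
  | start : ReachesIn M x 0 M.startConfig
  | step {n : ℕ} {c : M.Config} {t : Action M.State M.Work M.k} :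
      ReachesIn M x n c → t ∈ M.actions x c → ReachesIn M x (n + 1) (M.apply x c t)

/-- A configuration is halting if no action is allowed in it. -/
def Halting (M : Machine A) (x : List A) (c : M.Config) : Prop :=
  M.actions x c = ∅

/-- `M` accepts `x` if some computation of `M` on `x` halts in an accepting state. -/
def Accepts (M : Machine A) (x : List A) : Prop :=
  ∃ n c, M.ReachesIn x n c ∧ M.Halting x c ∧ c.state ∈ M.accepting

/-- No computation of `M` on `x` makes more than `t` steps. -/
def TimeAtMost (M : Machine A) (x : List A) (t : ℕ) : Prop :=
  ∀ n c, M.ReachesIn x n c → n ≤ t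

/-- In every computation of `M` on `x`, at most `s` cells of each work tape are visited
(the cells visited on a tape are `0, …, p`, where `p` is the rightmost head position). -/
def SpaceAtMost (M : Machine A) (x : List A) (s : ℝ) : Prop :=
  ∀ n c, M.ReachesIn x n c → ∀ i, (c.pos i : ℝ) + 1 ≤ s

/-- `M` accepts exactly the strings of `P`. -/
def Recognizes (M : Machine A) (P : Language A) : Prop :=
  ∀ x, M.Accepts x ↔ x ∈ P

/-- `M` is deterministic, halts on every input string and accepts exactly the strings of `P`. -/
def Decides (M : Machine A) (P : Language A) : Prop :=
  M.Deterministic ∧ (∀ x, ∃ n c, M.ReachesIn x n c ∧ M.Halting x c) ∧ M.Recognizes P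

/-- `M` uses space at most `c log |x| + d` for some constants `c, d ≥ 0`
(logarithms are to base `2`, with `log 0 = 0`). -/
def UsesLogSpace (M : Machine A) : Prop :=
  ∃ c d : ℝ, 0 ≤ c ∧ 0 ≤ d ∧ ∀ x : List A, M.SpaceAtMost x (c * Real.logb 2 x.length + d)

end Machine

/-- The class `L`: languages, over arbitrary finite alphabets, decided by deterministic Turing
machines in logarithmic space. -/
def classL : Set (Σ A : Type, Language A) :=
  {P | Finite P.1 ∧ ∃ M : Machine P.1, M.Decides P.2 ∧ M.UsesLogSpace}

/-- The class `NL`: languages, over arbitrary finite alphabets, recognized by nondeterministic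
Turing machines in logarithmic space. -/
def classNL : Set (Σ A : Type, Language A) :=
  {P | Finite P.1 ∧ ∃ M : Machine P.1, M.Recognizes P.2 ∧ M.UsesLogSpace}

/-- Polylogarithmic functions: `ℓ n = p (log n)` for a polynomial `p` with nonnegative integer
coefficients. -/
def IsPolylog (l : ℕ → ℝ) : Prop :=
  ∃ p : Polynomial ℕ, ∀ n : ℕ, l n = Polynomial.aeval (Real.logb 2 (n : ℝ)) p

/-! ## 2CNF formulas -/

/-- A literal: a variable, named by a binary string, or (if `positive` is false) its negation. -/
structure Literal where
  var : List Bool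
  positive : Bool

/-- A clause: a disjunction of one or two literals. -/
inductive Clause
  | single (a : Literal)
  | pair (a b : Literal)

/-- The literals of a clause, with multiplicity. -/
def Clause.literals : Clause → List Literal
  | .single a => [a]
  | .pair a b => [a, b]

/-- The alphabet in which formulas are written. -/
inductive Symb
  | zero
  | one
  | pos
  | neg
  | clauseEnd

/-- A literal is written as its sign followed by the name of its variable. -/
def Literal.encode (a : Literal) : List Symb :=
  (if a.positive then Symb.pos else Symb.neg) :: a.var.map (fun b => if b then Symb.one else Symb.zero)

/-- A clause is written as its literals followed by an end mark. -/
def Clause.encode (C : Clause) : List Symb :=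
  C.literals.flatMap Literal.encode ++ [Symb.clauseEnd]

/-- A 2CNF formula is a conjunction of clauses, given as a list; the formulas that serve as
problem instances are the nonempty ones. -/
abbrev Formula := List Clause

namespace Formula

/-- A formula is written as the concatenation of its clauses. -/
def encode (φ : Formula) : List Symb :=
  φ.flatMap Clause.encode

/-- All occurrences of literals in a formula. -/
def literals (φ : Formula) : List Literal :=
  φ.flatMap Clause.literals

/-- The number of (distinct) variables that appear in a formula. -/
def mvbl (φ : Formula) : ℕ :=
  (φ.literals.map Literal.var).toFinset.card

/-- The number of occurrences of the literals `v` and `¬v` in a formula. -/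
def occurrences (φ : Formula) (v : List Bool) : ℕ :=
  (φ.literals.map Literal.var).count v

/-- Some truth assignment makes some literal of every clause true. -/
def Satisfiable (φ : Formula) : Prop :=
  ∃ σ : List Bool → Bool, ∀ C ∈ φ, ∃ a ∈ C.literals, σ a.var = a.positive

end Formula

/-- `2SAT_k`: the (encodings of) satisfiable 2CNF formulas in which every variable occurs, negated
or not, at most `k` times. -/
def twoSAT (k : ℕ) : Language Symb :=
  {x | ∃ φ : Formula, φ ≠ [] ∧ φ.encode = x ∧ φ.Satisfiable ∧ ∀ v, φ.occurrences v ≤ k}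

/-- The linear space hypothesis for `2SAT_3`: for no `ε ∈ (0,1)` and no polylogarithmic `ℓ` is there
a deterministic Turing machine that decides `2SAT_3` in polynomial time and uses, on every
2CNF formula, written as `x`, at most `m_vbl(x) ^ ε * ℓ(|x|)` space. -/
def LinearSpaceHypothesis : Prop :=
  ∀ ε : ℝ, 0 < ε → ε < 1 → ∀ l : ℕ → ℝ, IsPolylog l →
    ¬ ∃ M : Machine Symb, M.Decides (twoSAT 3) ∧
      (∃ p : Polynomial ℕ, ∀ x : List Symb, M.TimeAtMost x (p.eval x.length)) ∧
      ∀ φ : Formula, φ ≠ [] →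
        M.SpaceAtMost φ.encode ((φ.mvbl : ℝ) ^ ε * l φ.encode.length)

end SpaceBounded

/-! Suppose that `L` and `NL` coincide. A string lies outside `2SAT_3` if it encodes no nonempty
formula, or some variable occurs four times, or some literal and its negation reach each other in
the implication graph. A nondeterministic search that remembers a bounded number of input positions
detects each of these, so the complement of `2SAT_3` is in `NL`, hence in `L`. Deterministic
deciders are complemented by exchanging accepting and rejecting states, so `2SAT_3` itself is in
`L`; closure of `NL` under complement is not needed. A halting deterministic computation repeats no
configuration, so logarithmic space gives polynomial time. A nonempty formula has m ≥ 1 variables,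
so the space c log|x| + d is at most m^(1/2) times a polylogarithmic function, against the
hypothesis.

Most of the work is membership in `NL`. Instead of building a Turing machine for the search, the
proof uses pointer programs: words of instructions for one input head and finitely many registers
holding input positions. A regular set of such words acts as a nondeterministic program. One generic
machine runs it, with the registers in binary on a single work tape (`Simulator.accepts_iff`,
`Simulator.usesLogSpace`). Product, sum and Kleene star of languages become composition, union and
reflexive transitive closure of relations between stores (`sem_mul`, `sem_add`, `sem_kstar`) and
preserve regularity, so the search can be assembled as a relation.

The combinatorial facts are `not_satisfiable_iff`, on contradictory cycles of the implication graph,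
and `many_succ_iff`, on counting occurrences. The passage between strings and formulas rests on
unique readability of the encoding. -/

/-! ## Closure properties of regular languages -/

namespace Language

variable {α β : Type}

/-- The left quotients of a product are determined by left quotients of the factors. -/
theorem leftQuotient_mul (L₁ L₂ : Language α) (w : List α) :
    (L₁ * L₂).leftQuotient w =
      {y | y ∈ L₁.leftQuotient w * L₂ ∨
        ∃ B ∈ {B : Language α | ∃ u v, u ∈ L₁ ∧ w = u ++ v ∧ B = L₂.leftQuotient v}, y ∈ B} := by
  ext y
  constructor
  · rintro ⟨u, hu, v, hv, h⟩
    rcases List.append_eq_append_iff.1 h with ⟨a, rfl, rfl⟩ | ⟨a, rfl, rfl⟩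
    · exact Or.inr ⟨_, ⟨u, a, hu, rfl, rfl⟩, hv⟩
    · exact Or.inl ⟨a, hu, v, hv, rfl⟩
  · rintro (⟨a, ha, v, hv, rfl⟩ | ⟨B, ⟨u, v, hu, rfl, rfl⟩, hy⟩)
    · exact ⟨w ++ a, ha, v, hv, by simp⟩
    · exact ⟨u, hu, v ++ y, hy, by simp⟩

/-- By Myhill–Nerode it suffices to count left quotients. Each quotient of the product is determined
by one quotient of `L₁` and a set of quotients of `L₂`, and there are finitely many such pairs. -/
theorem IsRegular.mul {L₁ L₂ : Language α} (h₁ : L₁.IsRegular) (h₂ : L₂.IsRegular) :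
    (L₁ * L₂).IsRegular := by
  apply IsRegular.of_finite_range_leftQuotient
  refine ((Set.Finite.image2 (fun (A : Language α) (S : Set (Language α)) =>
    ({y | y ∈ A * L₂ ∨ ∃ B ∈ S, y ∈ B} : Language α)) h₁.finite_range_leftQuotient
    h₂.finite_range_leftQuotient.powerset).subset ?_)
  rintro _ ⟨w, rfl⟩
  refine ⟨_, ⟨w, rfl⟩, _, ?_, (leftQuotient_mul L₁ L₂ w).symm⟩
  rintro _ ⟨u, v, -, -, rfl⟩
  exact ⟨v, rfl⟩

/-- A proper prefix of a product of words cuts one of the factors. -/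
theorem exists_of_append_mem_kstar {L : Language α} {w y : List α} (hw : w ≠ [])
    (h : w ++ y ∈ KStar.kstar L) :
    ∃ u v y₁ y₂, u ∈ KStar.kstar L ∧ w = u ++ v ∧ v ++ y₁ ∈ L ∧ y₂ ∈ KStar.kstar L ∧
      y = y₁ ++ y₂ := by
  obtain ⟨S, hS, hL⟩ := Language.mem_kstar.1 h
  clear h
  induction S generalizing w with
  | nil => simp at hS; exact absurd hS.1 hw
  | cons a S ih =>
    have hS' : S.flatten ∈ KStar.kstar L :=
      Language.join_mem_kstar fun y hy => hL y (by simp [hy])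
    rw [List.flatten_cons] at hS
    rcases List.append_eq_append_iff.1 hS with ⟨b, rfl, rfl⟩ | ⟨b, rfl, hb⟩
    · exact ⟨[], w, b, S.flatten, Language.nil_mem_kstar _, rfl, hL _ (by simp), hS', rfl⟩
    -- The first factor ends inside `w`. If it ends exactly where `w` does, the cut is put at its
    -- end with `y₁` empty, because the induction hypothesis requires a nonempty rest of `w`.
    · by_cases hb0 : b = []
      · subst hb0
        refine ⟨[], a, [], S.flatten, Language.nil_mem_kstar _, by simp, by simpa using hL a (by simp),
          hS', by simpa using hb.symm⟩
      · obtain ⟨u, v, y₁, y₂, hu, rfl, hv, hy₂, rfl⟩ :=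
          ih hb0 hb.symm (fun y hy => hL y (by simp [hy]))
        refine ⟨a ++ u, v, y₁, y₂, ?_, by simp, hv, hy₂, rfl⟩
        obtain ⟨T, rfl, hT⟩ := Language.mem_kstar.1 hu
        refine Language.mem_kstar.2 ⟨a :: T, by simp, ?_⟩
        intro z hz
        rcases List.mem_cons.1 hz with rfl | hz
        · exact hL _ (by simp)
        · exact hT z hz

theorem append_mem_kstar {L : Language α} {u v : List α} (hu : u ∈ KStar.kstar L)
    (hv : v ∈ KStar.kstar L) : u ++ v ∈ KStar.kstar L := by
  obtain ⟨S, rfl, hS⟩ := Language.mem_kstar.1 hu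
  obtain ⟨T, rfl, hT⟩ := Language.mem_kstar.1 hv
  refine Language.mem_kstar.2 ⟨S ++ T, by simp, fun z hz => ?_⟩
  rcases List.mem_append.1 hz with hz | hz
  exacts [hS z hz, hT z hz]

theorem mem_kstar_of_mem {L : Language α} {u : List α} (hu : u ∈ L) : u ∈ KStar.kstar L :=
  Language.mem_kstar.2 ⟨[u], by simp, by simpa using hu⟩

/-- For nonempty `w` the quotient is determined by the set of quotients of `L` by those suffixes of
`w` that start a new factor, that is, by a subset of a finite set. The empty word is treated apart:
there is then no factor to cut, and the quotient is the star itself. -/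
theorem IsRegular.kstar {L : Language α} (h : L.IsRegular) : (KStar.kstar L).IsRegular := by
  apply IsRegular.of_finite_range_leftQuotient
  refine ((h.finite_range_leftQuotient.powerset.image (fun S : Set (Language α) =>
    ({y | ∃ B ∈ S, y ∈ B * KStar.kstar L} : Language α))).union
      (Set.finite_singleton (KStar.kstar L))).subset ?_
  rintro _ ⟨w, rfl⟩
  by_cases hw : w = []
  · right
    subst hw
    rfl
  · left
    refine ⟨{B | ∃ u v, u ∈ KStar.kstar L ∧ w = u ++ v ∧ B = L.leftQuotient v}, ?_, ?_⟩
    · rintro _ ⟨u, v, -, -, rfl⟩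
      exact ⟨v, rfl⟩
    · ext y
      constructor
      · rintro ⟨_, ⟨u, v, hu, rfl, rfl⟩, y₁, hy₁, y₂, hy₂, rfl⟩
        have := append_mem_kstar (append_mem_kstar hu (mem_kstar_of_mem hy₁)) hy₂
        show _ ∈ KStar.kstar L
        simpa using this
      · intro hy
        obtain ⟨u, v, y₁, y₂, hu, rfl, hv, hy₂, rfl⟩ := exists_of_append_mem_kstar hw hy
        exact ⟨_, ⟨u, v, hu, rfl, rfl⟩, y₁, hv, y₂, hy₂, rfl⟩

theorem isRegular_singleton (a : α) : ({[a]} : Language α).IsRegular := by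
  apply IsRegular.of_finite_range_leftQuotient
  refine (Set.toFinite {({[a]} : Language α), ({[]} : Language α), (∅ : Set (List α))}).subset ?_
  rintro _ ⟨w, rfl⟩
  match w with
  | [] => left; rfl
  | b :: w =>
    right
    by_cases h : b = a ∧ w = []
    · left
      obtain ⟨rfl, rfl⟩ := h
      ext y
      show b :: y ∈ ({[b]} : Set (List α)) ↔ y ∈ ({[]} : Set (List α))
      simp
    · right
      ext y
      show b :: (w ++ y) ∈ ({[a]} : Set (List α)) ↔ y ∈ (∅ : Set (List α))
      simp only [Set.mem_singleton_iff, List.cons.injEq, List.append_eq_nil_iff,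
        Set.mem_empty_iff_false, iff_false]
      tauto

theorem isRegular_one : (1 : Language α).IsRegular := by
  apply IsRegular.of_finite_range_leftQuotient
  refine (Set.toFinite {(1 : Language α), (∅ : Set (List α))}).subset ?_
  rintro _ ⟨w, rfl⟩
  match w with
  | [] => left; rfl
  | b :: w =>
    right
    ext y
    show b :: (w ++ y) ∈ ({[]} : Set (List α)) ↔ y ∈ (∅ : Set (List α))
    simp

theorem isRegular_zero : (0 : Language α).IsRegular := by
  apply IsRegular.of_finite_range_leftQuotient
  refine (Set.toFinite {(0 : Language α)}).subset ?_
  rintro _ ⟨w, rfl⟩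
  rfl

theorem isRegular_sum {ι : Type} {S : Finset ι} {K : ι → Language α}
    (h : ∀ i, (K i).IsRegular) : (∑ i ∈ S, K i).IsRegular := by
  classical
  induction S using Finset.induction_on with
  | empty => exact isRegular_zero
  | insert i S hi ih => rw [Finset.sum_insert hi]; exact (h i).add ih

/-- The words obtained from the words of `K` by replacing each letter `a` by `f a, b`. -/
def interleave (f : α → β) (b : β) (K : Language α) : Language β :=
  {w | ∃ u ∈ K, w = u.flatMap fun a => [f a, b]}

/-- A quotient is of one of three kinds: the interleaving of a quotient of `K`, the same with a `b`
still due in front, or empty. -/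
theorem IsRegular.interleave {K : Language α} (hK : K.IsRegular) {f : α → β}
    (hf : Function.Injective f) (b : β) : (K.interleave f b).IsRegular := by
  apply IsRegular.of_finite_range_leftQuotient
  have hfin := hK.finite_range_leftQuotient
  refine (((hfin.image (Language.interleave f b)).union (hfin.image fun A : Language α =>
    ({y | ∃ z ∈ A.interleave f b, y = b :: z} : Language β))).union
      (Set.finite_singleton (∅ : Set (List β)))).subset ?_
  -- Two letters are consumed per round, so the induction is on a bound for the length, with the
  -- quotient of `K` reached so far as a parameter.
  have key : ∀ (n : ℕ) (w : List β), w.length ≤ n → ∀ u : List α,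
      ((K.leftQuotient u).interleave f b).leftQuotient w ∈
      (Language.interleave f b '' Set.range K.leftQuotient ∪
        (fun A : Language α => ({y | ∃ z ∈ A.interleave f b, y = b :: z} : Language β)) ''
          Set.range K.leftQuotient) ∪ {(∅ : Set (List β))} := by
    intro n
    induction n with
    | zero =>
      intro w hw u
      obtain rfl : w = [] := by simpa using hw
      exact Or.inl (Or.inl ⟨_, ⟨u, rfl⟩, rfl⟩)
    | succ n ih =>
      intro w hw u
      match w with
      | [] => exact Or.inl (Or.inl ⟨_, ⟨u, rfl⟩, rfl⟩)
      | c :: w =>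
        by_cases hc : ∃ a, f a = c
        · obtain ⟨a, rfl⟩ := hc
          have step : ((K.leftQuotient u).interleave f b).leftQuotient [f a] =
              {y | ∃ z ∈ (K.leftQuotient (u ++ [a])).interleave f b, y = b :: z} := by
            ext y
            constructor
            · rintro ⟨v, hv, h⟩
              match v with
              | [] => simp at h
              | a' :: v =>
                simp only [List.flatMap_cons, List.cons_append, List.nil_append,
                  List.cons.injEq] at h
                obtain ⟨h1, rfl⟩ := h
                obtain rfl := hf h1
                exact ⟨_, ⟨v, by rw [leftQuotient_append]; exact hv, rfl⟩, rfl⟩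
            · rintro ⟨_, ⟨v, hv, rfl⟩, rfl⟩
              rw [leftQuotient_append] at hv
              exact ⟨a :: v, hv, by simp⟩
          match w with
          | [] => exact Or.inl (Or.inr ⟨_, ⟨u ++ [a], rfl⟩, step.symm⟩)
          | d :: w =>
            have e : ((K.leftQuotient u).interleave f b).leftQuotient (f a :: d :: w) =
                (((K.leftQuotient u).interleave f b).leftQuotient [f a]).leftQuotient (d :: w) :=
              leftQuotient_append _ [f a] (d :: w)
            rw [e, step]
            by_cases hd : d = b
            · subst hd
              have : Language.leftQuotient ({y | ∃ z ∈ (K.leftQuotient (u ++ [a])).interleave f d,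
                  y = d :: z} : Language β) (d :: w) =
                  ((K.leftQuotient (u ++ [a])).interleave f d).leftQuotient w := by
                ext y
                constructor
                · rintro ⟨z, hz, h⟩
                  simp only [List.cons_append, List.cons.injEq, true_and] at h
                  subst h
                  exact hz
                · intro hy
                  exact ⟨_, hy, rfl⟩
              rw [this]
              exact ih w (by simp at hw; omega) _
            · right
              ext y
              constructor
              · rintro ⟨z, hz, h⟩
                simp only [List.cons_append, List.cons.injEq] at h
                exact (hd h.1).elim
              · exact False.elim
        · right
          ext y
          constructor
          · rintro ⟨v, hv, h⟩
            match v with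
            | [] => simp at h
            | a' :: v =>
              simp only [List.flatMap_cons, List.cons_append, List.cons.injEq] at h
              exact (hc ⟨a', h.1.symm⟩).elim
          · exact False.elim
  rintro _ ⟨w, rfl⟩
  exact key w.length w le_rfl []

end Language

/-! ## Pointer programs and their simulation in logarithmic space -/

namespace SpaceBounded

/-- Instructions of a pointer program, which has a head on the input tape and `m` registers that
hold positions of the head. -/
inductive Instr (A : Type) (m : ℕ)
  | left
  | right
  | save (i : Fin m)
  | eq (i : Fin m)
  | sym (a : InputSymbol A)

instance {A : Type} [Finite A] : Finite (InputSymbol A) := by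
  refine Finite.of_injective
    (fun a : InputSymbol A => match a with
      | .leftEnd => (Sum.inl true : Bool ⊕ A) | .rightEnd => Sum.inl false
      | .letter a => Sum.inr a) ?_
  rintro (_ | _ | _) (_ | _ | _) h <;> simp_all

instance {A : Type} [Finite A] {m : ℕ} : Finite (Instr A m) := by
  refine Finite.of_injective
    (fun a : Instr A m => match a with
      | .left => (Sum.inl (Sum.inl true) : (Bool ⊕ InputSymbol A) ⊕ (Bool × Fin m))
      | .right => Sum.inl (Sum.inl false)
      | .sym a => Sum.inl (Sum.inr a)
      | .save i => Sum.inr (true, i)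
      | .eq i => Sum.inr (false, i)) ?_
  rintro (_ | _ | _ | _ | _) (_ | _ | _ | _ | _) h <;> simp_all

/-- The data of a pointer program: the head position and the contents of the registers. -/
abbrev Store (m : ℕ) := ℕ × (Fin m → ℕ)

namespace Instr

variable {A : Type} {m : ℕ}

/-- The effect of an instruction on input `x`. -/
def Step (x : List A) : Instr A m → Store m → Store m → Prop
  | left, s, s' => 0 < s.1 ∧ s' = (s.1 - 1, s.2)
  | right, s, s' => s.1 ≤ x.length ∧ s' = (s.1 + 1, s.2)
  | save i, s, s' => s' = (s.1, Function.update s.2 i s.1)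
  | eq i, s, s' => s.2 i = s.1 ∧ s' = s
  | sym a, s, s' => Machine.inputAt x s.1 = a ∧ s' = s

/-- The effect of a sequence of instructions. -/
def Exec (x : List A) : List (Instr A m) → Store m → Store m → Prop
  | [], s, s' => s = s'
  | a :: w, s, s' => ∃ t, a.Step x s t ∧ Exec x w t s'

theorem exec_append {x : List A} {v w : List (Instr A m)} {s s' : Store m} :
    Exec x (v ++ w) s s' ↔ ∃ t, Exec x v s t ∧ Exec x w t s' := by
  induction v generalizing s with
  | nil => simp [Exec]
  | cons a v ih =>
    simp only [List.cons_append, Exec, ih]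
    constructor
    · rintro ⟨t, h, t', h', h''⟩
      exact ⟨t', ⟨t, h, h'⟩, h''⟩
    · rintro ⟨t', ⟨t, h, h'⟩, h''⟩
      exact ⟨t, h, t', h', h''⟩

theorem exec_singleton {x : List A} {a : Instr A m} {s s' : Store m} :
    Exec x [a] s s' ↔ a.Step x s s' := by
  simp [Exec]

/-! ### Registers in binary, and instructions executed digit by digit -/

/-- A cell of the work tape holds one binary digit of the head position and of each register. -/
abbrev Cell (m : ℕ) := Bool × (Fin m → Bool)

/-- The number with the binary digits `f c`, least significant digit first. -/
def val (f : Cell m → Bool) : List (Cell m) → ℕ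
  | [] => 0
  | c :: l => (f c).toNat + 2 * val f l

/-- The store represented by the cells. -/
def rep (l : List (Cell m)) : Store m :=
  (val Prod.fst l, fun i => val (fun c => c.2 i) l)

/-- The scanned input symbol allows the instruction. -/
def Guard : Instr A m → InputSymbol A → Prop
  | left, b => b ≠ .leftEnd
  | right, b => b ≠ .rightEnd
  | sym a, b => b = a
  | _, _ => True

/-- The movement of the input head. -/
def inputMove : Instr A m → Move
  | left => .left
  | right => .right
  | _ => .stay

/-- The processing of one cell, with a flag that is a carry, a borrow or the result of a test. -/
def cell : Instr A m → Bool → Cell m → Bool × Cell m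
  | right, s, c => (s && c.1, xor s c.1, c.2)
  | left, s, c => (s && !c.1, xor s c.1, c.2)
  | save i, s, c => (s, c.1, Function.update c.2 i c.1)
  | eq i, s, c => (s && (c.2 i == c.1), c)
  | sym _, s, c => (s, c)

/-- The cells that are appended after the last cell, `none` if the instruction fails. -/
def finish : Instr A m → Bool → Option (Option (Cell m))
  | right, true => some (some (true, fun _ => false))
  | left, true => none
  | eq _, false => none
  | _, _ => some none

/-- The effect of an instruction on the cells. -/
def sweep (a : Instr A m) : Bool → List (Cell m) → Option (List (Cell m))
  | s, [] => (a.finish s).map Option.toList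
  | s, c :: l => (a.sweep (a.cell s c).1 l).map fun l' => (a.cell s c).2 :: l'

/-- Addition with ripple carry. A cell is appended only if the carry leaves the last digit, and then
the new value is at least 2 to the old length; this clause is what later bounds the number of cells.
-/
theorem sweep_right (s : Bool) (l : List (Cell m)) :
    ∃ l', (right : Instr A m).sweep s l = some l' ∧
      val Prod.fst l' = val Prod.fst l + s.toNat ∧
      (∀ i, val (fun c => c.2 i) l' = val (fun c => c.2 i) l) ∧
      (l'.length = l.length ∨ l'.length = l.length + 1 ∧ 2 ^ l.length ≤ val Prod.fst l') := by
  induction l generalizing s with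
  | nil => cases s <;> simp [sweep, finish, val]
  | cons c l ih =>
    obtain ⟨l', h1, h2, h3, h4⟩ := ih (s && c.1)
    refine ⟨_, by rw [sweep]; simp only [cell]; rw [h1]; rfl, ?_, ?_, ?_⟩
    · simp only [val, h2]
      cases s <;> cases c.1 <;> simp <;> ring
    · intro i
      simp only [val, h3]
    · simp only [List.length_cons, val, pow_succ]
      omega

/-- Subtraction with ripple borrow; the hypothesis ensures that the borrow is absorbed, so that
`finish` does not fail. Leading zeros are kept. -/
theorem sweep_left (s : Bool) (l : List (Cell m)) (h : s.toNat ≤ val Prod.fst l) :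
    ∃ l', (left : Instr A m).sweep s l = some l' ∧
      val Prod.fst l' = val Prod.fst l - s.toNat ∧
      (∀ i, val (fun c => c.2 i) l' = val (fun c => c.2 i) l) ∧ l'.length = l.length := by
  induction l generalizing s with
  | nil => cases s <;> simp_all [sweep, finish, val]
  | cons c l ih =>
    have h0 : (s && !c.1).toNat ≤ val Prod.fst l := by
      simp only [val] at h
      cases s <;> cases hc : c.1 <;> simp_all; omega
    obtain ⟨l', h1, h2, h3, h4⟩ := ih _ h0
    refine ⟨_, by rw [sweep]; simp only [cell]; rw [h1]; rfl, ?_, ?_, ?_⟩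
    · simp only [val, h2]
      revert h0
      cases s <;> cases c.1 <;> simp; omega
    · intro i
      simp only [val, h3]
    · simp only [List.length_cons, h4]

theorem sweep_save (i : Fin m) (s : Bool) (l : List (Cell m)) :
    ∃ l', (save i : Instr A m).sweep s l = some l' ∧
      rep l' = ((rep l).1, Function.update (rep l).2 i (rep l).1) ∧ l'.length = l.length := by
  induction l generalizing s with
  | nil =>
    refine ⟨[], by cases s <;> simp [sweep, finish], ?_, rfl⟩
    simp only [rep, val, Prod.mk.injEq, true_and]
    ext j
    by_cases h : j = i <;> simp [Function.update, h]
  | cons c l ih =>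
    obtain ⟨l', h1, h2, h3⟩ := ih s
    refine ⟨_, by rw [sweep]; simp only [cell]; rw [h1]; rfl, ?_, by simp [h3]⟩
    simp only [rep, Prod.mk.injEq] at h2 ⊢
    refine ⟨by simp only [val, h2.1], ?_⟩
    ext j
    have := congrFun h2.2 j
    simp only [val, this]
    by_cases h : j = i
    · subst h
      simp
    · simp [Function.update, h]

/-- Both numbers are written in the same cells, so they have equally many digits and are equal
exactly if all digits agree; the flag records agreement so far. -/
theorem sweep_eq (i : Fin m) (s : Bool) (l l' : List (Cell m)) :
    (eq i : Instr A m).sweep s l = some l' ↔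
      l' = l ∧ s = true ∧ val (fun c => c.2 i) l = val Prod.fst l := by
  induction l generalizing s l' with
  | nil => cases s <;> simp [sweep, finish, val, eq_comm]
  | cons c l ih =>
    have e : val (fun c => c.2 i) (c :: l) = val Prod.fst (c :: l) ↔
        c.2 i = c.1 ∧ val (fun c => c.2 i) l = val Prod.fst l := by
      simp only [val]
      cases c.2 i <;> cases c.1 <;> simp <;> omega
    rw [sweep, e]
    simp only [Option.map_eq_some_iff, cell, ih]
    constructor
    · rintro ⟨_, ⟨rfl, h1, h2⟩, rfl⟩
      simp_all
    · rintro ⟨rfl, rfl, h1, h2⟩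
      exact ⟨l, ⟨rfl, by simp [h1], h2⟩, rfl⟩

theorem sweep_sym (a : InputSymbol A) (s : Bool) (l : List (Cell m)) :
    (sym a : Instr A m).sweep s l = some l := by
  induction l generalizing s with
  | nil => simp [sweep, finish]
  | cons c l ih => rw [sweep]; simp [cell, ih]

theorem inputAt_eq_leftEnd {x : List A} {p : ℕ} : Machine.inputAt x p = .leftEnd ↔ p = 0 := by
  cases p with
  | zero => simp [Machine.inputAt]
  | succ p => cases h : x[p]? <;> simp [Machine.inputAt, h]

theorem inputAt_eq_rightEnd {x : List A} {p : ℕ} :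
    Machine.inputAt x p = .rightEnd ↔ x.length < p := by
  cases p with
  | zero => simp [Machine.inputAt]
  | succ p =>
    cases h : x[p]? with
    | none => simp [Machine.inputAt, h]; simpa using h
    | some a => simp [Machine.inputAt, h]; exact (List.getElem?_eq_some_iff.1 h).1

/-- The precondition of an instruction splits into what the scanned input symbol shows (`Guard`: not
at an end marker, or the prescribed symbol) and what only the digits show (the equality test,
through failure of `sweep`). -/
theorem step_iff_sweep {x : List A} {a : Instr A m} {l : List (Cell m)} {s' : Store m} :
    a.Step x (rep l) s' ↔ a.Guard (Machine.inputAt x (rep l).1) ∧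
      ∃ l', a.sweep true l = some l' ∧ rep l' = s' := by
  cases a with
  | left =>
    simp only [Step, Guard, Ne, inputAt_eq_leftEnd, ← Nat.pos_iff_ne_zero]
    refine and_congr_right fun h => ?_
    obtain ⟨l', h1, h2, h3, -⟩ := sweep_left (A := A) true l h
    have : rep l' = ((rep l).1 - 1, (rep l).2) := Prod.ext h2 (funext h3)
    simp [h1, this, eq_comm]
  | right =>
    simp only [Step, Guard, Ne, inputAt_eq_rightEnd, not_lt]
    refine and_congr_right fun h => ?_
    obtain ⟨l', h1, h2, h3, -⟩ := sweep_right (A := A) true l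
    have : rep l' = ((rep l).1 + 1, (rep l).2) := Prod.ext h2 (funext h3)
    simp [h1, this, eq_comm]
  | save i =>
    obtain ⟨l', h1, h2, -⟩ := sweep_save (A := A) i true l
    simp [Step, Guard, h1, h2, eq_comm]
  | eq i =>
    simp only [Step, Guard, sweep_eq, true_and]
    constructor
    · rintro ⟨h, rfl⟩
      exact ⟨l, ⟨rfl, h⟩, rfl⟩
    · rintro ⟨_, ⟨rfl, h⟩, rfl⟩
      exact ⟨h, rfl⟩
  | sym a => simp [Step, Guard, sweep_sym, eq_comm]

theorem Step.fst_le {x : List A} {a : Instr A m} {s t : Store m} (h : a.Step x s t)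
    (hs : s.1 ≤ x.length + 1) : t.1 ≤ x.length + 1 := by
  cases a <;> simp only [Step] at h
  · rw [h.2]; dsimp only; omega
  · rw [h.2]; dsimp only; omega
  · rw [h]; exact hs
  · rw [h.2]; exact hs
  · rw [h.2]; exact hs

/-- The machine's own input head is kept at the position written in binary, so input symbols are
read directly. The cap in `moveInput` never acts, since `right` requires a position of at most
`x.length`. -/
theorem Step.fst_eq {x : List A} {a : Instr A m} {s t : Store m} (h : a.Step x s t) :
    t.1 = Machine.moveInput x s.1 a.inputMove := by
  cases a <;> simp only [Step] at h <;> simp only [inputMove, Machine.moveInput]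
  · rw [h.2]
  · rw [h.2]; dsimp only; omega
  · rw [h]
  · rw [h.2]
  · rw [h.2]

/-- The number of cells in use is logarithmic in the length of the input. -/
theorem two_pow_length_le {x : List A} {a : Instr A m} {l l' : List (Cell m)}
    (h : a.Step x (rep l) (rep l')) (hl : a.sweep true l = some l')
    (hb : 2 ^ l.length ≤ 2 * (x.length + 1)) : 2 ^ l'.length ≤ 2 * (x.length + 1) := by
  have eq_of : l'.length = l.length → 2 ^ l'.length ≤ 2 * (x.length + 1) := fun e => e ▸ hb
  cases a with
  | left =>
    obtain ⟨l'', h1, -, -, h2⟩ := sweep_left (A := A) true l h.1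
    rw [hl] at h1
    obtain rfl := Option.some.inj h1
    exact eq_of h2
  | right =>
    obtain ⟨l'', h1, -, -, h2⟩ := sweep_right (A := A) true l
    rw [hl] at h1
    obtain rfl := Option.some.inj h1
    rcases h2 with h2 | ⟨h2, h3⟩
    · exact eq_of h2
    -- On overflow 2 to the old length is at most the new position, which is at most `x.length + 1`;
    -- one more cell doubles this, whence the factor 2 in the bound.
    · have h4 : val Prod.fst l' = val Prod.fst l + 1 := congrArg Prod.fst h.2
      have h5 : val Prod.fst l ≤ x.length := h.1
      rw [h2, pow_succ]
      omega
  | save i =>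
    obtain ⟨l'', h1, -, h2⟩ := sweep_save (A := A) i true l
    rw [hl] at h1
    obtain rfl := Option.some.inj h1
    exact eq_of h2
  | eq i => exact eq_of (by rw [((sweep_eq i true l l').1 hl).1])
  | sym a =>
    rw [sweep_sym] at hl
    exact eq_of (by rw [Option.some.inj hl])

end Instr

end SpaceBounded

/-! ### The machine that simulates a regular set of pointer programs -/

namespace SpaceBounded

open Instr

namespace Simulator

variable {A : Type} {m : ℕ} {σ : Type}

/-- The states of the machine that simulates the pointer programs accepted by a finite automaton
with state set `σ`: the work head waits in the first cell, runs to the right while an instruction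
is executed, or runs back to the left. -/
inductive State (A : Type) (m : ℕ) (σ : Type)
  | ready (q : σ)
  | sweep (q : σ) (a : Instr A m) (s : Bool)
  | back (q : σ)
  | accept

instance [Finite A] [Finite σ] : Finite (State A m σ) := by
  refine Finite.of_injective
    (fun a : State A m σ => match a with
      | .ready q => (Sum.inl (some (q, true)) : Option (σ × Bool) ⊕ (σ × Instr A m × Bool))
      | .back q => Sum.inl (some (q, false))
      | .accept => Sum.inl none
      | .sweep q a s => Sum.inr (q, a, s)) ?_
  rintro (_ | _ | _ | _) (_ | _ | _ | _) h <;> simp_all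

/-- The work symbols: a mark for the first cell of the tape, and digits. -/
abbrev Work (m : ℕ) := Bool × Option (Cell m)

/-- An action on a single work tape. -/
def act (p : State A m σ) (mv : Move) (g : Work m) (wm : Move) :
    Action (State A m σ) (Work m) 1 :=
  ⟨p, mv, fun _ => g, fun _ => wm⟩

theorem exists_act (t : Action (State A m σ) (Work m) 1) : ∃ p mv g wm, t = act p mv g wm := by
  obtain ⟨p, mv, g, wm⟩ := t
  have hg : g = fun _ => g 0 := funext fun i => by rw [Subsingleton.elim i 0]
  have hw : wm = fun _ => wm 0 := funext fun i => by rw [Subsingleton.elim i 0]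
  exact ⟨p, mv, g 0, wm 0, congrArg₂ (Action.mk p mv) hg hw⟩

theorem act_inj {p p' : State A m σ} {mv mv' wm wm' : Move} {g g' : Work m}
    (h : act p mv g wm = act p' mv' g' wm') : p = p' ∧ mv = mv' ∧ g = g' ∧ wm = wm' := by
  simp only [act, Action.mk.injEq] at h
  exact ⟨h.1, h.2.1, congrFun h.2.2.1 0, congrFun h.2.2.2 0⟩

/-- The transitions. -/
inductive Trans (D : DFA (Instr A m) σ) :
    State A m σ → InputSymbol A → Work m → Action (State A m σ) (Work m) 1 → Prop
  | choose {q a b g} : a.Guard b →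
      Trans D (.ready q) b g (act (.sweep (D.step q a) a true) a.inputMove (true, none) .right)
  | halt {q b g} : q ∈ D.accept → Trans D (.ready q) b g (act .accept .stay g .stay)
  | cell {q a s b c} : Trans D (.sweep q a s) b (false, some c)
      (act (.sweep q a (a.cell s c).1) .stay (false, some (a.cell s c).2) .right)
  | finish {q a s b o} : a.finish s = some o →
      Trans D (.sweep q a s) b (false, none) (act (.back q) .stay (false, o) .left)
  | back {q b c} : Trans D (.back q) b (false, c) (act (.back q) .stay (false, c) .left)
  | home {q b c} : Trans D (.back q) b (true, c) (act (.ready q) .stay (true, c) .stay)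

/-- The simulating machine. -/
def machine [Finite A] [Finite σ] (D : DFA (Instr A m) σ) : Machine A where
  State := State A m σ
  stateFinite := inferInstance
  Work := Work m
  workFinite := inferInstance
  blank := (false, none)
  k := 1
  start := .ready D.start
  accepting := {.accept}
  trans := fun p b g => {t | Trans D p b (g 0) t}

variable {D : DFA (Instr A m) σ} {x : List A}

/-- The cells after the first one hold the digits `l`. -/
def Holds (T : ℕ → Work m) (l : List (Cell m)) : Prop :=
  ∀ p, T (p + 1) = (false, l[p]?)

theorem Holds.update_zero {T : ℕ → Work m} {l : List (Cell m)} (h : Holds T l) (g : Work m) :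
    Holds (Function.update T 0 g) l := fun p => by
  rw [Function.update_of_ne (by omega), h p]

theorem Holds.update {T : ℕ → Work m} {l₁ l₂ : List (Cell m)} {c c' : Cell m}
    (h : Holds T (l₁ ++ c :: l₂)) :
    Holds (Function.update T (l₁.length + 1) (false, some c')) ((l₁ ++ [c']) ++ l₂) := fun p => by
  by_cases hp : p = l₁.length
  · subst hp
    simp
  · rw [Function.update_of_ne (by omega), h p]
    rcases lt_or_gt_of_ne hp with hp | hp
    · simp [List.getElem?_append, hp]
    · obtain ⟨k, rfl⟩ := Nat.exists_eq_add_of_lt hp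
      simp [List.getElem?_append, Nat.add_assoc]

theorem Holds.update_end {T : ℕ → Work m} {l : List (Cell m)} (h : Holds T l)
    (o : Option (Cell m)) :
    Holds (Function.update T (l.length + 1) (false, o)) (l ++ o.toList) := fun p => by
  by_cases hp : p = l.length
  · subst hp
    cases o <;> simp
  · rw [Function.update_of_ne (by omega), h p]
    rcases lt_or_gt_of_ne hp with hp | hp
    · simp [List.getElem?_append, hp]
    · cases o
      · simp
      · have : l.length + 1 ≤ p := hp
        rw [List.getElem?_eq_none (by omega), List.getElem?_eq_none (by simpa using this)]

theorem update_self_eq {T : ℕ → Work m} {w : ℕ} {g : Work m} (h : T w = g) :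
    Function.update T w g = T := by
  subst h
  simp

/-- The digits `l` represent a store that some program leading the automaton to `q` produces. -/
def Good (D : DFA (Instr A m) σ) (x : List A) (q : σ) (h : ℕ) (l : List (Cell m)) : Prop :=
  (rep l).1 = h ∧ h ≤ x.length + 1 ∧ 2 ^ l.length ≤ 2 * (x.length + 1) ∧
    ∃ w, D.eval w = q ∧ Exec x w (0, 0) (rep l)

/-- The invariant of the simulation. -/
def Inv (D : DFA (Instr A m) σ) (x : List A) (h : ℕ) (T : ℕ → Work m) (w : ℕ) :
    State A m σ → Prop
  | .ready q => w = 0 ∧ ∃ l, Good D x q h l ∧ Holds T l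
  | .sweep q a s => T 0 = (true, none) ∧ ∃ l₁ l₂, w = l₁.length + 1 ∧ Holds T (l₁ ++ l₂) ∧
      2 ^ (l₁ ++ l₂).length ≤ 2 * (x.length + 1) ∧
      ∀ l', a.sweep s l₂ = some l' → Good D x q h (l₁ ++ l')
  | .back q => T 0 = (true, none) ∧ ∃ l, w ≤ l.length + 1 ∧ Good D x q h l ∧ Holds T l
  | .accept => w = 0 ∧ ∃ u ∈ D.accepts, ∃ s, Exec x u (0, 0) s

/-- In the middle of a sweep the invariant is a promise: if the sweep of the remaining digits
succeeds, the completed list is good. Since `sweep` recurses along the list, each processed cell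
passes the promise on, and `finish` redeems it. -/
theorem inv_step {p p' : State A m σ} {h w : ℕ} {T : ℕ → Work m} {mv wm : Move} {g : Work m}
    (hi : Inv D x h T w p) (ht : Trans D p (Machine.inputAt x h) (T w) (act p' mv g wm)) :
    Inv D x (Machine.moveInput x h mv) (Function.update T w g) (Machine.moveWork w wm) p' := by
  -- The action and the scanned symbol become variables, so that case analysis on the transition can
  -- unify its indices.
  obtain ⟨t, hT, e⟩ : ∃ t, Trans D p (Machine.inputAt x h) (T w) t ∧ t = act p' mv g wm :=
    ⟨_, ht, rfl⟩
  obtain ⟨b, hb⟩ : ∃ b, T w = b := ⟨_, rfl⟩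
  rw [hb] at hT
  cases hT with
  | @choose q a b _ hg =>
    obtain ⟨rfl, rfl, rfl, rfl⟩ := act_inj e
    obtain ⟨rfl, l, ⟨h1, h2, h3, u, h4, h5⟩, h6⟩ := hi
    refine ⟨by simp, [], l, rfl, h6.update_zero _, h3, fun l' hl' => ?_⟩
    subst h1
    have hs : a.Step x (rep l) (rep l') := step_iff_sweep.2 ⟨hg, l', hl', rfl⟩
    refine ⟨hs.fst_eq, ?_, two_pow_length_le hs hl' h3, u ++ [a], ?_, ?_⟩
    · rw [← hs.fst_eq]
      exact hs.fst_le h2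
    · rw [DFA.eval_append_singleton, h4]
    · exact exec_append.2 ⟨_, h5, exec_singleton.2 hs⟩
  | @halt q _ _ hq =>
    obtain ⟨rfl, rfl, rfl, rfl⟩ := act_inj e
    obtain ⟨rfl, l, ⟨-, -, -, u, h4, h5⟩, -⟩ := hi
    exact ⟨rfl, u, by rw [DFA.mem_accepts, h4]; exact hq, _, h5⟩
  | @cell q a s _ c =>
    obtain ⟨rfl, rfl, rfl, rfl⟩ := act_inj e
    obtain ⟨h0, l₁, l₂, rfl, h2, h3, h4⟩ := hi
    have h5 := h2 l₁.length
    rw [hb] at h5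
    cases l₂ with
    | nil => simp at h5
    | cons c' l₂ =>
      obtain rfl : c = c' := by simpa using h5
      refine ⟨by rw [Function.update_of_ne (by omega), h0], l₁ ++ [(a.cell s c).2], l₂,
        by simp [Machine.moveWork], h2.update, by simpa using h3, fun l' hl' => ?_⟩
      have := h4 _ (by rw [sweep, hl']; rfl)
      simpa [Machine.moveInput] using this
  | @finish q a s _ o ho =>
    obtain ⟨rfl, rfl, rfl, rfl⟩ := act_inj e
    obtain ⟨h0, l₁, l₂, rfl, h2, h3, h4⟩ := hi
    have h5 := h2 l₁.length
    rw [hb] at h5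
    cases l₂ with
    | cons c' l₂ => simp at h5
    | nil =>
      rw [List.append_nil] at h2
      exact ⟨by rw [Function.update_of_ne (by omega), h0], l₁ ++ o.toList,
        by simp [Machine.moveWork]; omega, h4 _ (by rw [sweep, ho]; rfl), h2.update_end o⟩
  | @back q _ c =>
    obtain ⟨rfl, rfl, rfl, rfl⟩ := act_inj e
    rw [update_self_eq hb]
    obtain ⟨h0, l, h1, h2, h3⟩ := hi
    exact ⟨h0, l, by simp [Machine.moveWork]; omega, h2, h3⟩
  | @home q _ c =>
    obtain ⟨rfl, rfl, rfl, rfl⟩ := act_inj e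
    rw [update_self_eq hb]
    obtain ⟨h0, l, h1, h2, h3⟩ := hi
    refine ⟨?_, l, h2, h3⟩
    -- Only cell 0 can carry the mark; every later cell carries `false` by `Holds`.
    cases w with
    | zero => rfl
    | succ w => rw [h3 w] at hb; simp at hb

variable [Finite A] [Finite σ]

/-- A configuration of the simulating machine. -/
def conf (D : DFA (Instr A m) σ) (p : State A m σ) (h : ℕ) (T : ℕ → Work m) (w : ℕ) :
    (machine D).Config :=
  ⟨p, h, fun _ => T, fun _ => w⟩

theorem exists_conf (c : (machine D).Config) : ∃ p h T w, c = conf D p h T w := by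
  obtain ⟨p, h, T, w⟩ := c
  refine ⟨p, h, T (0 : Fin 1), w (0 : Fin 1), ?_⟩
  have hT : T = fun _ => T (0 : Fin 1) :=
    funext fun i : Fin 1 => by rw [Subsingleton.elim i 0]
  have hw : w = fun _ => w (0 : Fin 1) :=
    funext fun i : Fin 1 => by rw [Subsingleton.elim i 0]
  exact congrArg₂ (Machine.Config.mk (M := machine D) p h) hT hw

theorem conf_inj {p p' : State A m σ} {h h' w w' : ℕ} {T T' : ℕ → Work m}
    (e : conf D p h T w = conf D p' h' T' w') : p = p' ∧ h = h' ∧ T = T' ∧ w = w' :=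
  ⟨congrArg Machine.Config.state e, congrArg Machine.Config.inputPos e,
    congrFun (congrArg Machine.Config.tape e) (0 : Fin 1),
    congrFun (congrArg Machine.Config.pos e) (0 : Fin 1)⟩

theorem apply_conf {p p' : State A m σ} {h w : ℕ} {T : ℕ → Work m} {mv wm : Move} {g : Work m} :
    (machine D).apply x (conf D p h T w) (act p' mv g wm) =
      conf D p' (Machine.moveInput x h mv) (Function.update T w g) (Machine.moveWork w wm) :=
  rfl

theorem mem_actions_conf {p : State A m σ} {h w : ℕ} {T : ℕ → Work m}
    {t : Action (State A m σ) (Work m) 1} :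
    t ∈ (machine D).actions x (conf D p h T w) ↔ Trans D p (Machine.inputAt x h) (T w) t :=
  Iff.rfl

theorem inv_of_reachesIn {n : ℕ} {c : (machine D).Config} (hc : (machine D).ReachesIn x n c)
    {p : State A m σ} {h w : ℕ} {T : ℕ → Work m} (e : c = conf D p h T w) : Inv D x h T w p := by
  induction hc generalizing p h T w with
  | start =>
    obtain ⟨rfl, rfl, rfl, rfl⟩ := conf_inj (show conf D (.ready D.start) 0
      (fun _ => (false, none)) 0 = conf D p h T w from e)
    refine ⟨rfl, [], ⟨rfl, by omega, by simp; omega, [], rfl, rfl⟩, fun p => by simp⟩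
  | @step n c t _ ht ih =>
    obtain ⟨p₀, h₀, T₀, w₀, rfl⟩ := exists_conf c
    obtain ⟨p₁, mv, g, wm, rfl⟩ := exists_act t
    rw [apply_conf] at e
    obtain ⟨rfl, rfl, rfl, rfl⟩ := conf_inj e
    exact inv_step (ih rfl) ht

/-- Reachability in some number of steps. -/
def Reach (D : DFA (Instr A m) σ) (x : List A) (p : State A m σ) (h : ℕ) (T : ℕ → Work m) (w : ℕ) :
    Prop :=
  ∃ n, (machine D).ReachesIn x n (conf D p h T w)

theorem Reach.step {p p' : State A m σ} {h w : ℕ} {T : ℕ → Work m} {mv wm : Move} {g : Work m}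
    (hr : Reach D x p h T w) (ht : Trans D p (Machine.inputAt x h) (T w) (act p' mv g wm)) :
    Reach D x p' (Machine.moveInput x h mv) (Function.update T w g) (Machine.moveWork w wm) := by
  obtain ⟨n, hn⟩ := hr
  exact ⟨n + 1, hn.step ht⟩

theorem Reach.back {q : σ} {h w : ℕ} {T : ℕ → Work m} {l : List (Cell m)}
    (hr : Reach D x (.back q) h T w) (h0 : T 0 = (true, none)) (hl : Holds T l) :
    Reach D x (.ready q) h T 0 := by
  induction w with
  | zero =>
    have := hr.step (by rw [h0]; exact .home)
    rwa [update_self_eq h0] at this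
  | succ w ih =>
    have := hr.step (by rw [hl w]; exact .back)
    rw [update_self_eq (hl w)] at this
    exact ih this

theorem Reach.sweep {q : σ} {a : Instr A m} {s : Bool} {h : ℕ} {T : ℕ → Work m}
    {l₁ l₂ l' : List (Cell m)} (hr : Reach D x (.sweep q a s) h T (l₁.length + 1))
    (h0 : T 0 = (true, none)) (hl : Holds T (l₁ ++ l₂)) (hs : a.sweep s l₂ = some l') :
    ∃ T', Reach D x (.ready q) h T' 0 ∧ Holds T' (l₁ ++ l') := by
  induction l₂ generalizing s T l₁ l' with
  | nil =>
    rw [Instr.sweep, Option.map_eq_some_iff] at hs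
    obtain ⟨o, ho, rfl⟩ := hs
    have h1 := hl l₁.length
    rw [List.append_nil] at hl h1
    rw [List.getElem?_eq_none le_rfl] at h1
    have := hr.step (by rw [h1]; exact .finish ho)
    exact ⟨_, this.back (by rw [Function.update_of_ne (by omega), h0]) (hl.update_end o),
      hl.update_end o⟩
  | cons c l₂ ih =>
    rw [Instr.sweep, Option.map_eq_some_iff] at hs
    obtain ⟨l'', h2, rfl⟩ := hs
    have h1 := hl l₁.length
    rw [List.getElem?_append_right le_rfl] at h1
    simp only [Nat.sub_self, List.getElem?_cons_zero] at h1
    have h3 := hr.step (by rw [h1]; exact .cell)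
    have e : Machine.moveWork (l₁.length + 1) .right = (l₁ ++ [(a.cell s c).2]).length + 1 := by
      simp [Machine.moveWork]
    rw [e] at h3
    obtain ⟨T', h4, h5⟩ := ih h3 (by rw [Function.update_of_ne (by omega), h0]) hl.update h2
    exact ⟨T', h4, by simpa using h5⟩

/-- Completeness of the simulation. The induction removes the last instruction, in accordance with
the automaton, which reads programs from left to right: one sweep and one return carry out that
instruction. -/
theorem reach_of_exec {u : List (Instr A m)} {s : Store m} (hu : Exec x u (0, 0) s) :
    ∃ l T, rep l = s ∧ Holds T l ∧ Reach D x (.ready (D.eval u)) s.1 T 0 := by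
  induction u using List.reverseRecOn generalizing s with
  | nil =>
    obtain rfl : ((0, 0) : Store m) = s := hu
    exact ⟨[], fun _ => (false, none), rfl, fun p => by simp, 0, .start⟩
  | append_singleton u a ih =>
    obtain ⟨t, ht, hs⟩ := exec_append.1 hu
    rw [exec_singleton] at hs
    obtain ⟨l, T, rfl, hl, hr⟩ := ih ht
    obtain ⟨hg, l', h1, rfl⟩ := step_iff_sweep.1 hs
    have h2 := hr.step (.choose hg)
    rw [← hs.fst_eq] at h2
    obtain ⟨T', h3, h4⟩ := Reach.sweep (l₁ := []) h2 (by simp) (hl.update_zero _) h1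
    refine ⟨l', T', rfl, h4, ?_⟩
    rw [DFA.eval_append_singleton]
    exact h3

/-- Soundness is the invariant at the state `accept`; completeness follows a successful program to
the point where the automaton accepts. No transition leaves `accept`, so the machine halts there. -/
theorem accepts_iff :
    (machine D).Accepts x ↔ ∃ u ∈ D.accepts, ∃ s, Exec x u (0, 0) s := by
  constructor
  · rintro ⟨n, c, hc, -, ha⟩
    obtain ⟨p, h, T, w, rfl⟩ := exists_conf c
    obtain rfl : p = .accept := ha
    exact (inv_of_reachesIn hc rfl).2
  · rintro ⟨u, hu, s, hs⟩
    obtain ⟨l, T, -, -, hr⟩ := reach_of_exec (D := D) hs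
    obtain ⟨n, hn⟩ := hr.step (.halt hu)
    refine ⟨n, _, hn, ?_, rfl⟩
    refine Set.eq_empty_of_forall_notMem fun t ht => ?_
    cases mem_actions_conf.1 ht

theorem usesLogSpace : (machine D).UsesLogSpace := by
  -- From 2^k ≤ 2(|x| + 1) follows k ≤ log|x| + 2 for the number k of digits. The head goes at most
  -- one cell beyond the digits, to position k + 1, and cell 0 is counted too: log|x| + 4 in all.
  refine ⟨1, 4, by norm_num, by norm_num, fun x n c hc i => ?_⟩
  obtain ⟨p, h, T, w, rfl⟩ := exists_conf c
  have hlen : ∀ k : ℕ, 2 ^ k ≤ 2 * (x.length + 1) → k ≤ Nat.log 2 x.length + 2 := by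
    intro k hk
    by_contra hlt
    have h1 : 2 ^ (Nat.log 2 x.length + 3) ≤ 2 ^ k := Nat.pow_le_pow_right (by norm_num) (by omega)
    have h2 : x.length < 2 ^ (Nat.log 2 x.length + 1) := Nat.lt_pow_succ_log_self (by norm_num) _
    rw [show Nat.log 2 x.length + 3 = (Nat.log 2 x.length + 1) + 2 by ring, pow_add] at h1
    omega
  have hw : w ≤ Nat.log 2 x.length + 3 := by
    have hi := inv_of_reachesIn hc rfl
    cases p with
    | ready q => rw [hi.1]; omega
    | accept => rw [hi.1]; omega
    | back q =>
      obtain ⟨-, l, h1, ⟨-, -, h2, -⟩, -⟩ := hi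
      have := hlen _ h2
      omega
    | sweep q a s =>
      obtain ⟨-, l₁, l₂, h1, -, h2, -⟩ := hi
      have := hlen _ h2
      simp only [List.length_append] at this
      omega
  have hlog : ((Nat.log 2 x.length : ℕ) : ℝ) ≤ Real.logb 2 x.length := by
    have := Real.natLog_le_logb x.length 2
    exact_mod_cast this
  have : ((w : ℕ) : ℝ) ≤ (Nat.log 2 x.length : ℕ) + 3 := by exact_mod_cast hw
  show ((w : ℕ) : ℝ) + 1 ≤ _
  linarith

end Simulator

/-- Acceptance by the pointer programs of a regular language takes logarithmic space. -/
theorem mem_classNL_of_isRegular {A : Type} [Finite A] {m : ℕ} {L : Language (Instr A m)}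
    (hL : L.IsRegular) {P : Language A}
    (hP : ∀ x, x ∈ P ↔ ∃ u ∈ L, ∃ s, Exec x u (0, 0) s) :
    (⟨A, P⟩ : Σ A : Type, Language A) ∈ classNL := by
  obtain ⟨σ, _, D, rfl⟩ := hL
  exact ⟨inferInstance, Simulator.machine D,
    fun x => by rw [Simulator.accepts_iff, hP], Simulator.usesLogSpace⟩

end SpaceBounded

/-! ## The relations computed by pointer programs -/

namespace SpaceBounded

namespace Instr

variable {A : Type} {m : ℕ}

/-- The relation between stores computed by the programs of a language. -/
def Sem (L : Language (Instr A m)) (x : List A) (s s' : Store m) : Prop :=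
  ∃ w ∈ L, Exec x w s s'

variable {L L' : Language (Instr A m)} {x : List A} {s s' : Store m}

theorem sem_instr {a : Instr A m} : Sem {[a]} x s s' ↔ a.Step x s s' := by
  constructor
  · rintro ⟨w, rfl, hw⟩
    exact exec_singleton.1 hw
  · intro h
    exact ⟨[a], rfl, exec_singleton.2 h⟩

/-- With `sem_add`, `sem_sum` and `sem_kstar` this makes `Sem` compatible with the regular
operations, so that programs can be written as regular expressions. -/
theorem sem_mul : Sem (L * L') x s s' ↔ ∃ t, Sem L x s t ∧ Sem L' x t s' := by
  constructor
  · rintro ⟨_, ⟨u, hu, v, hv, rfl⟩, h⟩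
    obtain ⟨t, h1, h2⟩ := exec_append.1 h
    exact ⟨t, ⟨u, hu, h1⟩, v, hv, h2⟩
  · rintro ⟨t, ⟨u, hu, h1⟩, v, hv, h2⟩
    exact ⟨u ++ v, ⟨u, hu, v, hv, rfl⟩, exec_append.2 ⟨t, h1, h2⟩⟩

theorem sem_add : Sem (L + L') x s s' ↔ Sem L x s s' ∨ Sem L' x s s' := by
  constructor
  · rintro ⟨u, hu | hu, h⟩
    exacts [Or.inl ⟨u, hu, h⟩, Or.inr ⟨u, hu, h⟩]
  · rintro (⟨u, hu, h⟩ | ⟨u, hu, h⟩)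
    exacts [⟨u, Or.inl hu, h⟩, ⟨u, Or.inr hu, h⟩]

theorem sem_sum {ι : Type} {S : Finset ι} {K : ι → Language (Instr A m)} :
    Sem (∑ i ∈ S, K i) x s s' ↔ ∃ i ∈ S, Sem (K i) x s s' := by
  classical
  induction S using Finset.induction_on with
  | empty =>
    simp only [Finset.sum_empty, Finset.notMem_empty, false_and, exists_false, iff_false]
    rintro ⟨u, hu, -⟩
    exact hu
  | insert i S hi ih => simp [Finset.sum_insert hi, sem_add, ih]

theorem sem_kstar :
    Sem (KStar.kstar L) x s s' ↔ Relation.ReflTransGen (Sem L x) s s' := by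
  constructor
  · rintro ⟨w, hw, h⟩
    obtain ⟨S, rfl, hS⟩ := Language.mem_kstar.1 hw
    clear hw
    induction S generalizing s with
    | nil =>
      obtain rfl : s = s' := h
      rfl
    | cons u S ih =>
      obtain ⟨t, h1, h2⟩ := exec_append.1 h
      exact .head ⟨u, hS u (by simp), h1⟩ (ih (fun v hv => hS v (by simp [hv])) h2)
  · intro h
    induction h using Relation.ReflTransGen.head_induction_on with
    | refl => exact ⟨[], Language.nil_mem_kstar _, rfl⟩
    | head h _ ih =>
      obtain ⟨u, hu, h1⟩ := h
      obtain ⟨v, hv, h2⟩ := ih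
      exact ⟨u ++ v, Language.append_mem_kstar (Language.mem_kstar_of_mem hu) hv,
        exec_append.2 ⟨_, h1, h2⟩⟩

/-- Move the head to the left end. -/
def home : Language (Instr A m) := KStar.kstar {[left]} * {[sym .leftEnd]}

/-- Move the head to an arbitrary position to the right. -/
def advance : Language (Instr A m) := KStar.kstar {[right]}

/-- Move the head to the position stored in a register. -/
def goto (i : Fin m) : Language (Instr A m) := home * (advance * {[eq i]})

/-- Move the head over a word of `K`. -/
def scan (K : Language A) : Language (Instr A m) := K.interleave (fun a => sym (.letter a)) right

theorem isRegular_home : (home : Language (Instr A m)).IsRegular :=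
  (Language.isRegular_singleton _).kstar.mul (Language.isRegular_singleton _)

theorem isRegular_advance : (advance : Language (Instr A m)).IsRegular :=
  (Language.isRegular_singleton _).kstar

theorem isRegular_goto (i : Fin m) : (goto i : Language (Instr A m)).IsRegular :=
  isRegular_home.mul (isRegular_advance.mul (Language.isRegular_singleton _))

theorem isRegular_scan {K : Language A} (hK : K.IsRegular) :
    (scan K : Language (Instr A m)).IsRegular :=
  hK.interleave (fun a b h => by simpa using h) _

/-- The star may stop anywhere, but the test for the left end marker discards every run that stops
early. -/
theorem sem_home : Sem home x s s' ↔ s' = (0, s.2) := by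
  simp only [home, sem_mul, sem_kstar, sem_instr, Step, inputAt_eq_leftEnd]
  constructor
  · rintro ⟨t, h1, h2, rfl⟩
    have : s'.2 = s.2 := by
      induction h1 using Relation.ReflTransGen.head_induction_on with
      | refl => rfl
      | head h _ ih =>
        rw [sem_instr, Step] at h
        rw [ih, h.2]
    exact Prod.ext h2 this
  · rintro rfl
    refine ⟨(0, s.2), ?_, rfl, rfl⟩
    obtain ⟨h, r⟩ := s
    induction h with
    | zero => rfl
    | succ h ih => exact .head (sem_instr.2 ⟨Nat.succ_pos _, rfl⟩) ih

theorem sem_advance (hs : s.1 ≤ x.length + 1) :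
    Sem advance x s s' ↔ s'.2 = s.2 ∧ s.1 ≤ s'.1 ∧ s'.1 ≤ x.length + 1 := by
  simp only [advance, sem_kstar]
  constructor
  · intro h
    induction h with
    | refl => exact ⟨rfl, le_rfl, hs⟩
    | tail _ h ih =>
      rw [sem_instr] at h
      obtain ⟨h1, rfl⟩ := h
      exact ⟨ih.1, by dsimp only; omega, by dsimp only; omega⟩
  · obtain ⟨h, r⟩ := s
    obtain ⟨h', r'⟩ := s'
    rintro ⟨h1, h2, h3⟩
    dsimp only at h1 h2 h3
    subst h1
    induction h', h2 using Nat.le_induction with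
    | base => rfl
    | succ k hk ih => exact (ih (by omega)).tail (sem_instr.2 ⟨by dsimp only; omega, rfl⟩)

/-- The distance to advance is guessed and the final test rejects wrong guesses. The bound appears
because an arbitrary store may hold a number beyond the right end marker, which the head cannot
reach. -/
theorem sem_goto {i : Fin m} :
    Sem (goto i) x s s' ↔ s.2 i ≤ x.length + 1 ∧ s' = (s.2 i, s.2) := by
  simp only [goto, sem_mul, sem_home, sem_instr, Step]
  constructor
  · rintro ⟨_, rfl, t, h1, h2, rfl⟩
    obtain ⟨h3, -, h4⟩ := (sem_advance (by simp)).1 h1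
    dsimp only at h3
    rw [h3] at h2
    exact ⟨by rw [h2]; exact h4, Prod.ext h2.symm h3⟩
  · rintro ⟨h, rfl⟩
    exact ⟨_, rfl, (s.2 i, s.2), (sem_advance (by simp)).2 ⟨rfl, by simp, h⟩, rfl, rfl⟩

/-! ### Input positions and the suffixes that begin there -/

/-- At position `p` the part `l` of the input begins. -/
def View (x : List A) (p : ℕ) (l : List A) : Prop :=
  ∃ k ≤ x.length, p = k + 1 ∧ x.drop k = l

theorem View.le {p : ℕ} {l : List A} (h : View x p l) : p ≤ x.length + 1 := by
  obtain ⟨k, hk, rfl, -⟩ := h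
  omega

theorem View.pos {p : ℕ} {l : List A} (h : View x p l) : 0 < p := by
  obtain ⟨k, hk, rfl, -⟩ := h
  omega

theorem View.unique {p : ℕ} {l l' : List A} (h : View x p l) (h' : View x p l') : l = l' := by
  obtain ⟨k, -, rfl, rfl⟩ := h
  obtain ⟨k', -, h, rfl⟩ := h'
  rw [Nat.succ.inj h]

theorem exists_view {p : ℕ} (h0 : 0 < p) (h : p ≤ x.length + 1) : ∃ l, View x p l :=
  ⟨_, p - 1, by omega, by omega, rfl⟩

theorem view_one : View x 1 x := ⟨0, by omega, rfl, rfl⟩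

theorem view_cons_iff {p : ℕ} {a : A} {l : List A} :
    View x p (a :: l) ↔ Machine.inputAt x p = .letter a ∧ View x (p + 1) l := by
  constructor
  · rintro ⟨k, hk, rfl, h⟩
    have h1 : x[k]? = some a := by
      rw [← List.head?_drop, h]; rfl
    refine ⟨by simp [Machine.inputAt, h1], k + 1, (List.getElem?_eq_some_iff.1 h1).1, rfl, ?_⟩
    rw [← List.tail_drop, h]; rfl
  · rintro ⟨h, k, hk, hp, rfl⟩
    obtain rfl : p = k := by omega
    cases p with
    | zero => simp [Machine.inputAt] at h
    | succ k =>
      cases h1 : x[k]? with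
      | none => simp [Machine.inputAt, h1] at h
      | some b =>
        obtain rfl : b = a := by simpa [Machine.inputAt, h1] using h
        obtain ⟨h2, h3⟩ := List.getElem?_eq_some_iff.1 h1
        exact ⟨k, by omega, rfl, by rw [← h3, List.drop_eq_getElem_cons h2]⟩

theorem view_of_view_append {p : ℕ} {u l : List A} :
    View x p (u ++ l) → View x (p + u.length) l := by
  induction u generalizing p with
  | nil => exact id
  | cons a u ih =>
    intro h
    have := ih (view_cons_iff.1 h).2
    rwa [List.length_cons, Nat.add_comm u.length, ← Nat.add_assoc]

theorem view_nil_iff {p : ℕ} : View x p [] ↔ p = x.length + 1 := by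
  constructor
  · rintro ⟨k, hk, rfl, h⟩
    rw [List.drop_eq_nil_iff] at h
    omega
  · rintro rfl
    exact ⟨_, le_rfl, rfl, List.drop_length⟩

theorem sem_scan {K : Language A} {p : ℕ} {r : Fin m → ℕ} {l : List A} (hp : View x p l) :
    Sem (scan K) x (p, r) s' ↔ ∃ u ∈ K, ∃ l', l = u ++ l' ∧ s' = (p + u.length, r) := by
  have key : ∀ (u : List A) (p : ℕ) (l : List A), View x p l →
      (Exec x (u.flatMap fun a => [sym (.letter a), right]) (p, r) s' ↔
        ∃ l', l = u ++ l' ∧ s' = (p + u.length, r)) := by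
    intro u
    induction u with
    | nil => intro p l _; simp [Exec, eq_comm]
    | cons a u ih =>
      intro p l hp
      rw [List.flatMap_cons, exec_append]
      constructor
      · rintro ⟨t, ⟨_, ⟨h1, rfl⟩, _, ⟨h2, rfl⟩, rfl⟩, h3⟩
        obtain ⟨l1, h4⟩ := exists_view (Nat.succ_pos p) (Nat.succ_le_succ h2)
        obtain rfl := hp.unique (view_cons_iff.2 ⟨h1, h4⟩)
        obtain ⟨l', rfl, rfl⟩ := (ih _ _ h4).1 h3
        exact ⟨l', rfl, by simp; omega⟩
      · rintro ⟨l', rfl, rfl⟩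
        obtain ⟨h1, h2⟩ := view_cons_iff.1 hp
        refine ⟨(p + 1, r), ⟨_, ⟨h1, rfl⟩, _, ⟨Nat.le_of_succ_le_succ h2.le, rfl⟩, rfl⟩, ?_⟩
        exact (ih _ _ h2).2 ⟨l', rfl, by simp; omega⟩
  constructor
  · rintro ⟨_, ⟨u, hu, rfl⟩, h⟩
    exact ⟨u, hu, (key u p l hp).1 h⟩
  · rintro ⟨u, hu, h⟩
    exact ⟨_, ⟨u, hu, rfl⟩, (key u p l hp).2 h⟩

end Instr

/-! ### Relations between four registers, computed with scratch space -/

open Instr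

/-- The contents of the first four of six registers. -/
def visible (s : Store 6) : Fin 4 → ℕ := fun i => s.2 (i.castAdd 2)

/-- A relation between the contents of four registers that is computed by pointer programs with two
auxiliary registers. -/
def Programmable {A : Type} (R : List A → (Fin 4 → ℕ) → (Fin 4 → ℕ) → Prop) : Prop :=
  ∃ L : Language (Instr A 6), L.IsRegular ∧
    ∀ x s v', (∃ s', Sem L x s s' ∧ visible s' = v') ↔ R x (visible s) v'

namespace Programmable

variable {A : Type} {R R' : List A → (Fin 4 → ℕ) → (Fin 4 → ℕ) → Prop}

/-- The definition of `Programmable` quantifies over every starting store, so the head position and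
scratch registers left behind by the first program cannot affect the second one. The same uniformity
serves the closure under iteration. -/
theorem comp (h : Programmable R) (h' : Programmable R') :
    Programmable fun x => Relation.Comp (R x) (R' x) := by
  obtain ⟨L, hL, h⟩ := h
  obtain ⟨L', hL', h'⟩ := h'
  refine ⟨L * L', hL.mul hL', fun x s v' => ?_⟩
  simp only [sem_mul]
  constructor
  · rintro ⟨s', ⟨t, h1, h2⟩, rfl⟩
    exact ⟨visible t, (h x s _).1 ⟨t, h1, rfl⟩, (h' x t _).1 ⟨s', h2, rfl⟩⟩
  · rintro ⟨_, h1, h2⟩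
    obtain ⟨t, h3, rfl⟩ := (h x s _).2 h1
    obtain ⟨s', h4, rfl⟩ := (h' x t _).2 h2
    exact ⟨s', ⟨t, h3, h4⟩, rfl⟩

theorem or (h : Programmable R) (h' : Programmable R') :
    Programmable fun x v v' => R x v v' ∨ R' x v v' := by
  obtain ⟨L, hL, h⟩ := h
  obtain ⟨L', hL', h'⟩ := h'
  refine ⟨L + L', hL.add hL', fun x s v' => ?_⟩
  simp only [sem_add, ← h, ← h', or_and_right, exists_or]

theorem reflTransGen (h : Programmable R) :
    Programmable fun x => Relation.ReflTransGen (R x) := by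
  obtain ⟨L, hL, h⟩ := h
  refine ⟨KStar.kstar L, hL.kstar, fun x s v' => ?_⟩
  simp only [sem_kstar]
  constructor
  · rintro ⟨s', h1, rfl⟩
    exact h1.lift visible fun a b hab => (h x a _).1 ⟨b, hab, rfl⟩
  · intro h1
    induction h1 with
    | refl => exact ⟨s, .refl, rfl⟩
    | tail _ h2 ih =>
      obtain ⟨t, h3, rfl⟩ := ih
      obtain ⟨s', h4, rfl⟩ := (h x t _).2 h2
      exact ⟨s', h3.tail h4, rfl⟩

theorem mem_classNL [Finite A] (h : Programmable R) {P : Language A}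
    (hP : ∀ x, x ∈ P ↔ ∃ v, R x 0 v) : (⟨A, P⟩ : Σ A : Type, Language A) ∈ classNL := by
  obtain ⟨L, hL, h⟩ := h
  refine mem_classNL_of_isRegular hL fun x => ?_
  rw [hP]
  constructor
  · rintro ⟨v, hv⟩
    obtain ⟨s, ⟨u, hu, hs⟩, -⟩ := (h x (0, 0) v).2 hv
    exact ⟨u, hu, s, hs⟩
  · rintro ⟨u, hu, s, hs⟩
    exact ⟨_, (h x (0, 0) _).1 ⟨s, ⟨u, hu, hs⟩, rfl⟩⟩

end Programmable

theorem visible_update (h : ℕ) (r : Fin 6 → ℕ) (i : Fin 4) (p : ℕ) :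
    visible (h, Function.update r (i.castAdd 2) p) = Function.update (visible (h, r)) i p := by
  ext j
  by_cases hj : j = i
  · subst hj
    simp [visible]
  · have : j.castAdd 2 ≠ i.castAdd 2 := fun h => hj (Fin.castAdd_injective 4 2 h)
    simp [visible, Function.update_of_ne hj, Function.update_of_ne this]

theorem visible_update_four (h : ℕ) (r : Fin 6 → ℕ) (p : ℕ) :
    visible (h, Function.update r 4 p) = visible (h, r) := by
  ext j
  fin_cases j <;> simp [visible, Function.update]

theorem visible_update_five (h : ℕ) (r : Fin 6 → ℕ) (p : ℕ) :
    visible (h, Function.update r 5 p) = visible (h, r) := by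
  ext j
  fin_cases j <;> simp [visible, Function.update]

variable {A : Type}

/-- Copying a register. -/
theorem programmable_assign (i j : Fin 4) :
    Programmable fun (x : List A) v v' => v j ≤ x.length + 1 ∧ v' = Function.update v i (v j) := by
  refine ⟨goto (j.castAdd 2) * {[save (i.castAdd 2)]},
    (isRegular_goto _).mul (Language.isRegular_singleton _), fun x s v' => ?_⟩
  simp only [sem_mul, sem_goto, sem_instr, Step]
  constructor
  · rintro ⟨_, ⟨_, ⟨h, rfl⟩, rfl⟩, rfl⟩
    exact ⟨h, visible_update _ _ _ _⟩
  · rintro ⟨h, rfl⟩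
    exact ⟨_, ⟨_, ⟨h, rfl⟩, rfl⟩, visible_update _ _ _ _⟩

/-- Guessing the content of a register. -/
theorem programmable_guess (i : Fin 4) :
    Programmable fun (x : List A) v v' => ∃ p ≤ x.length + 1, v' = Function.update v i p := by
  refine ⟨home * (advance * {[save (i.castAdd 2)]}),
    isRegular_home.mul (isRegular_advance.mul (Language.isRegular_singleton _)), fun x s v' => ?_⟩
  simp only [sem_mul, sem_home, sem_instr, Step]
  constructor
  · rintro ⟨_, ⟨_, rfl, ⟨p, r⟩, h, rfl⟩, rfl⟩
    obtain ⟨h1, -, h2⟩ := (sem_advance (by simp)).1 h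
    dsimp only at h1 h2
    subst h1
    exact ⟨p, h2, visible_update _ _ _ _⟩
  · rintro ⟨p, h, rfl⟩
    exact ⟨_, ⟨_, rfl, (p, s.2), (sem_advance (by simp)).2 ⟨rfl, by simp, h⟩, rfl⟩,
      visible_update _ _ _ _⟩

/-- Guessing a position to the right of another one. -/
theorem programmable_later (i j : Fin 4) :
    Programmable fun (x : List A) v v' =>
      ∃ p ≤ x.length + 1, v j < p ∧ v' = Function.update v i p := by
  refine ⟨goto (j.castAdd 2) * ({[right]} * (advance * {[save (i.castAdd 2)]})),
    (isRegular_goto _).mul ((Language.isRegular_singleton _).mul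
      (isRegular_advance.mul (Language.isRegular_singleton _))), fun x s v' => ?_⟩
  simp only [sem_mul, sem_goto, sem_instr, Step]
  constructor
  · rintro ⟨_, ⟨_, ⟨-, rfl⟩, _, ⟨h0, rfl⟩, ⟨p, r⟩, h, rfl⟩, rfl⟩
    obtain ⟨h1, h3, h2⟩ := (sem_advance (Nat.succ_le_succ h0)).1 h
    dsimp only at h1 h2 h3
    subst h1
    exact ⟨p, h2, h3, visible_update _ _ _ _⟩
  · rintro ⟨p, h, h1, rfl⟩
    have h2 : s.2 (j.castAdd 2) < p := h1
    exact ⟨_, ⟨_, ⟨by omega, rfl⟩, _, ⟨by dsimp only; omega, rfl⟩, (p, s.2),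
      (sem_advance (by dsimp only; omega)).2 ⟨rfl, h2, h⟩, rfl⟩, visible_update _ _ _ _⟩

/-- Testing that the input does not belong to a regular language. -/
theorem programmable_notMem {K : Language A} (hK : K.IsRegular) :
    Programmable fun (x : List A) v v' => x ∉ K ∧ v' = v := by
  refine ⟨home * ({[right]} * (scan Kᶜ * {[sym .rightEnd]})),
    isRegular_home.mul ((Language.isRegular_singleton _).mul
      ((isRegular_scan hK.compl).mul (Language.isRegular_singleton _))), fun x s v' => ?_⟩
  simp only [sem_mul, sem_home, sem_instr, Step]
  constructor
  · rintro ⟨_, ⟨_, rfl, _, ⟨-, rfl⟩, t, h, h', rfl⟩, rfl⟩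
    obtain ⟨u, hu, l', hx, rfl⟩ := (sem_scan view_one).1 h
    -- The right end marker after the scan forces the scanned word to be the whole input.
    rw [inputAt_eq_rightEnd] at h'
    have h1 : x.length = u.length + l'.length := by rw [hx, List.length_append]
    obtain rfl : l' = [] := by
      rw [← List.length_eq_zero_iff]
      dsimp only at h'
      omega
    rw [List.append_nil] at hx
    subst hx
    exact ⟨hu, rfl⟩
  · rintro ⟨h, rfl⟩
    refine ⟨_, ⟨_, rfl, _, ⟨by simp, rfl⟩, (1 + x.length, s.2),
      (sem_scan view_one).2 ⟨x, h, [], by simp, rfl⟩, ?_, rfl⟩, rfl⟩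
    rw [inputAt_eq_rightEnd]
    dsimp only
    omega

end SpaceBounded

/-! ## Formulas as strings -/

namespace SpaceBounded

open Instr

/-- The symbol of a binary digit. -/
def bit (b : Bool) : Symb := if b then .one else .zero

/-- The symbol of a sign. -/
def sgn (b : Bool) : Symb := if b then .pos else .neg

theorem Literal.encode_eq (a : Literal) : a.encode = sgn a.positive :: a.var.map bit := rfl

theorem bit_injective : Function.Injective bit := by
  intro a b; cases a <;> cases b <;> simp [bit]

theorem sgn_injective : Function.Injective sgn := by
  intro a b; cases a <;> cases b <;> simp [sgn]

theorem sgn_ne_bit (a b : Bool) : sgn a ≠ bit b := by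
  cases a <;> cases b <;> simp [sgn, bit]

theorem clauseEnd_ne_bit (b : Bool) : Symb.clauseEnd ≠ bit b := by
  cases b <;> simp [bit]

theorem clauseEnd_ne_sgn (b : Bool) : Symb.clauseEnd ≠ sgn b := by
  cases b <;> simp [sgn]

instance : Finite Symb := by
  refine Finite.of_injective
    (fun a : Symb => match a with
      | .zero => (0 : Fin 5) | .one => 1 | .pos => 2 | .neg => 3 | .clauseEnd => 4) ?_
  rintro (_ | _ | _ | _ | _) (_ | _ | _ | _ | _) h <;> simp_all

/-- The string does not begin with a digit. -/
def NoBit (l : List Symb) : Prop := ∀ b l', l ≠ bit b :: l'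

theorem noBit_nil : NoBit [] := fun _ _ h => by simp at h

theorem noBit_encode_append (a : Literal) (l : List Symb) : NoBit (a.encode ++ l) := by
  intro b l' h
  rw [Literal.encode_eq, List.cons_append, List.cons.injEq] at h
  exact sgn_ne_bit _ _ h.1

theorem noBit_clauseEnd (l : List Symb) : NoBit (.clauseEnd :: l) := by
  intro b l' h
  rw [List.cons.injEq] at h
  exact clauseEnd_ne_bit _ h.1

/-- Since neither remainder begins with a digit, both names are the maximal initial run of digits.
-/
theorem map_bit_append_inj {u v : List Bool} {l l' : List Symb} (hl : NoBit l) (hl' : NoBit l')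
    (h : u.map bit ++ l = v.map bit ++ l') : u = v ∧ l = l' := by
  induction u generalizing v with
  | nil =>
    cases v with
    | nil => exact ⟨rfl, h⟩
    | cons b v => exact (hl _ _ h).elim
  | cons a u ih =>
    cases v with
    | nil => exact (hl' _ _ h.symm).elim
    | cons b v =>
      simp only [List.map_cons, List.cons_append, List.cons.injEq] at h
      obtain ⟨rfl, rfl⟩ := ih h.2
      exact ⟨by rw [bit_injective h.1], rfl⟩

theorem Literal.encode_append_inj {a b : Literal} {l l' : List Symb} (hl : NoBit l)
    (hl' : NoBit l') (h : a.encode ++ l = b.encode ++ l') : a = b ∧ l = l' := by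
  simp only [Literal.encode_eq, List.cons_append, List.cons.injEq] at h
  obtain ⟨h1, h2⟩ := map_bit_append_inj hl hl' h.2
  cases a
  cases b
  have h3 := sgn_injective h.1
  exact ⟨by simp_all, h2⟩

theorem Clause.encode_single (a : Literal) : (Clause.single a).encode = a.encode ++ [.clauseEnd] := by
  simp [Clause.encode, Clause.literals]

theorem Clause.encode_pair (a b : Literal) :
    (Clause.pair a b).encode = a.encode ++ (b.encode ++ [.clauseEnd]) := by
  simp [Clause.encode, Clause.literals]

/-- After the first literal comes an end mark or a sign, which tells clauses with one literal from
those with two. This is the core of unique readability. -/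
theorem Clause.encode_append_inj {C D : Clause} {l l' : List Symb}
    (h : C.encode ++ l = D.encode ++ l') : C = D ∧ l = l' := by
  have end_ne : ∀ (a : Literal) (l l' : List Symb), a.encode ++ l ≠ .clauseEnd :: l' := by
    intro a l l' h
    rw [Literal.encode_eq, List.cons_append, List.cons.injEq] at h
    exact clauseEnd_ne_sgn _ h.1.symm
  cases C <;> cases D <;>
    simp only [Clause.encode_single, Clause.encode_pair, List.append_assoc, List.cons_append,
      List.nil_append] at h
  · obtain ⟨rfl, h'⟩ := Literal.encode_append_inj (noBit_clauseEnd _) (noBit_clauseEnd _) h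
    exact ⟨rfl, by simpa using h'⟩
  · obtain ⟨-, h'⟩ := Literal.encode_append_inj (noBit_clauseEnd _) (noBit_encode_append _ _) h
    exact (end_ne _ _ _ h'.symm).elim
  · obtain ⟨-, h'⟩ := Literal.encode_append_inj (noBit_encode_append _ _) (noBit_clauseEnd _) h
    exact (end_ne _ _ _ h').elim
  · obtain ⟨rfl, h'⟩ :=
      Literal.encode_append_inj (noBit_encode_append _ _) (noBit_encode_append _ _) h
    obtain ⟨rfl, h''⟩ := Literal.encode_append_inj (noBit_clauseEnd _) (noBit_clauseEnd _) h'
    exact ⟨rfl, by simpa using h''⟩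

theorem Clause.encode_ne_nil (C : Clause) : C.encode ≠ [] := by
  simp [Clause.encode]

theorem Formula.encode_cons (C : Clause) (φ : Formula) :
    Formula.encode (C :: φ) = C.encode ++ Formula.encode φ := rfl

theorem Formula.encode_append (φ ψ : Formula) :
    Formula.encode (φ ++ ψ) = Formula.encode φ ++ Formula.encode ψ :=
  List.flatMap_append

theorem Formula.encode_injective {φ ψ : Formula} (h : φ.encode = ψ.encode) : φ = ψ := by
  induction φ generalizing ψ with
  | nil =>
    cases ψ with
    | nil => rfl
    | cons D ψ =>
      rw [Formula.encode_cons] at h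
      exact (D.encode_ne_nil (List.append_eq_nil_iff.1 h.symm).1).elim
  | cons C φ ih =>
    cases ψ with
    | nil =>
      rw [Formula.encode_cons] at h
      exact (C.encode_ne_nil (List.append_eq_nil_iff.1 h).1).elim
    | cons D ψ =>
      rw [Formula.encode_cons, Formula.encode_cons] at h
      obtain ⟨rfl, h'⟩ := Clause.encode_append_inj h
      rw [ih h']

/-- A program only guesses a prefix that parses as some `ψ`; unique readability makes `ψ` consist of
the first clauses of `φ`, so the string read next is a true clause of `φ`. -/
theorem Formula.mem_of_encode_eq {φ ψ : Formula} {C : Clause} {l : List Symb}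
    (h : φ.encode = ψ.encode ++ (C.encode ++ l)) : C ∈ φ := by
  induction ψ generalizing φ with
  | nil =>
    cases φ with
    | nil => exact (C.encode_ne_nil (List.append_eq_nil_iff.1 (show C.encode ++ l = [] from h.symm)).1).elim
    | cons D φ =>
      obtain ⟨rfl, -⟩ := Clause.encode_append_inj (Formula.encode_cons _ _ ▸ h)
      exact List.mem_cons_self
  | cons E ψ ih =>
    rw [Formula.encode_cons, List.append_assoc] at h
    cases φ with
    | nil => exact (E.encode_ne_nil (List.append_eq_nil_iff.1 h.symm).1).elim
    | cons D φ =>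
      obtain ⟨-, h'⟩ := Clause.encode_append_inj (Formula.encode_cons _ _ ▸ h)
      exact List.mem_cons_of_mem _ (ih h')

/-! ### Regular languages of formulas -/

/-- The strings of digits. -/
def bitLang : Language Symb := KStar.kstar ({[.zero]} + {[.one]})

/-- The encodings of literals. -/
def literalLang : Language Symb := ({[.pos]} + {[.neg]}) * bitLang

/-- The encodings of clauses. -/
def clauseLang : Language Symb := literalLang * ((1 + literalLang) * {[.clauseEnd]})

theorem mem_bitLang {w : List Symb} : w ∈ bitLang ↔ ∃ u : List Bool, w = u.map bit := by
  constructor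
  · intro h
    obtain ⟨S, rfl, hS⟩ := Language.mem_kstar.1 h
    clear h
    induction S with
    | nil => exact ⟨[], rfl⟩
    | cons y S ih =>
      obtain ⟨u, hu⟩ := ih fun z hz => hS z (by simp [hz])
      rcases hS y (by simp) with hy | hy
      · exact ⟨false :: u, by rw [List.flatten_cons, hu, Set.mem_singleton_iff.1 hy]; rfl⟩
      · exact ⟨true :: u, by rw [List.flatten_cons, hu, Set.mem_singleton_iff.1 hy]; rfl⟩
  · rintro ⟨u, rfl⟩
    refine Language.mem_kstar.2 ⟨u.map fun b => [bit b], ?_, ?_⟩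
    · induction u with
      | nil => rfl
      | cons b u ih => simpa using ih
    · intro y hy
      obtain ⟨b, -, rfl⟩ := List.mem_map.1 hy
      cases b
      exacts [Or.inl rfl, Or.inr rfl]

theorem mem_literalLang {w : List Symb} : w ∈ literalLang ↔ ∃ a : Literal, w = a.encode := by
  constructor
  · rintro ⟨_, rfl | rfl, v, hv, rfl⟩ <;> obtain ⟨u, rfl⟩ := mem_bitLang.1 hv
    exacts [⟨⟨u, true⟩, rfl⟩, ⟨⟨u, false⟩, rfl⟩]
  · rintro ⟨⟨u, p⟩, rfl⟩
    refine ⟨[sgn p], ?_, _, mem_bitLang.2 ⟨u, rfl⟩, rfl⟩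
    cases p
    exacts [Or.inr rfl, Or.inl rfl]

theorem mem_clauseLang {w : List Symb} : w ∈ clauseLang ↔ ∃ C : Clause, w = C.encode := by
  constructor
  · rintro ⟨_, hv, _, ⟨_, hu, _, rfl, rfl⟩, rfl⟩
    obtain ⟨a, rfl⟩ := mem_literalLang.1 hv
    rcases hu with rfl | hu
    · exact ⟨.single a, (Clause.encode_single a).symm⟩
    · obtain ⟨b, rfl⟩ := mem_literalLang.1 hu
      exact ⟨.pair a b, (Clause.encode_pair a b).symm⟩
  · rintro ⟨C, rfl⟩
    cases C with
    | single a =>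
      rw [Clause.encode_single]
      exact ⟨_, mem_literalLang.2 ⟨a, rfl⟩, _, ⟨[], Or.inl rfl, _, rfl, rfl⟩, rfl⟩
    | pair a b =>
      rw [Clause.encode_pair]
      exact ⟨_, mem_literalLang.2 ⟨a, rfl⟩, _,
        ⟨_, Or.inr (mem_literalLang.2 ⟨b, rfl⟩), _, rfl, rfl⟩, rfl⟩

theorem mem_kstar_clauseLang {w : List Symb} :
    w ∈ KStar.kstar clauseLang ↔ ∃ φ : Formula, w = φ.encode := by
  constructor
  · intro h
    obtain ⟨S, rfl, hS⟩ := Language.mem_kstar.1 h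
    clear h
    induction S with
    | nil => exact ⟨[], rfl⟩
    | cons y S ih =>
      obtain ⟨φ, hφ⟩ := ih fun z hz => hS z (by simp [hz])
      obtain ⟨C, rfl⟩ := mem_clauseLang.1 (hS y (by simp))
      exact ⟨C :: φ, by rw [List.flatten_cons, hφ, Formula.encode_cons]⟩
  · rintro ⟨φ, rfl⟩
    refine Language.mem_kstar.2 ⟨φ.map Clause.encode, rfl, fun y hy => ?_⟩
    obtain ⟨C, -, rfl⟩ := List.mem_map.1 hy
    exact mem_clauseLang.2 ⟨C, rfl⟩

/-- The encodings of nonempty formulas. -/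
def formulaLang : Language Symb := clauseLang * KStar.kstar clauseLang

theorem mem_formulaLang {w : List Symb} :
    w ∈ formulaLang ↔ ∃ φ : Formula, φ ≠ [] ∧ φ.encode = w := by
  constructor
  · rintro ⟨_, hu, _, hv, rfl⟩
    obtain ⟨C, rfl⟩ := mem_clauseLang.1 hu
    obtain ⟨φ, rfl⟩ := mem_kstar_clauseLang.1 hv
    exact ⟨C :: φ, by simp, rfl⟩
  · rintro ⟨φ, hφ, rfl⟩
    cases φ with
    | nil => exact (hφ rfl).elim
    | cons C φ => exact ⟨_, mem_clauseLang.2 ⟨C, rfl⟩, _, mem_kstar_clauseLang.2 ⟨φ, rfl⟩, rfl⟩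

theorem isRegular_literalLang : literalLang.IsRegular :=
  ((Language.isRegular_singleton _).add (Language.isRegular_singleton _)).mul
    ((Language.isRegular_singleton _).add (Language.isRegular_singleton _)).kstar

theorem isRegular_clauseLang : clauseLang.IsRegular :=
  isRegular_literalLang.mul
    ((Language.isRegular_one.add isRegular_literalLang).mul (Language.isRegular_singleton _))

theorem isRegular_formulaLang : formulaLang.IsRegular :=
  isRegular_clauseLang.mul isRegular_clauseLang.kstar

/-! ### Literals at positions of the input -/

/-- The literal `a` is written at position `p`. -/
def LitAt (x : List Symb) (p : ℕ) (a : Literal) : Prop :=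
  ∃ l, View x p (a.encode ++ l) ∧ NoBit l

theorem LitAt.unique {x : List Symb} {p : ℕ} {a b : Literal} (h : LitAt x p a)
    (h' : LitAt x p b) : a = b := by
  obtain ⟨l, h1, h2⟩ := h
  obtain ⟨l', h3, h4⟩ := h'
  exact (Literal.encode_append_inj h2 h4 (h1.unique h3)).1

theorem LitAt.le {x : List Symb} {p : ℕ} {a : Literal} (h : LitAt x p a) : p ≤ x.length + 1 := by
  obtain ⟨l, h1, -⟩ := h
  exact h1.le

/-- Positions of the literals of a common clause, equal if the clause has one literal only. -/
inductive Pick (x : List Symb) : ℕ → ℕ → Prop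
  | single (ψ : Formula) (a : Literal) (l : List Symb) :
      x = ψ.encode ++ ((Clause.single a).encode ++ l) →
      Pick x (1 + ψ.encode.length) (1 + ψ.encode.length)
  | pair (ψ : Formula) (a b : Literal) (l : List Symb) :
      x = ψ.encode ++ ((Clause.pair a b).encode ++ l) →
      Pick x (1 + ψ.encode.length) (1 + ψ.encode.length + a.encode.length)
  | swap (ψ : Formula) (a b : Literal) (l : List Symb) :
      x = ψ.encode ++ ((Clause.pair a b).encode ++ l) →
      Pick x (1 + ψ.encode.length + a.encode.length) (1 + ψ.encode.length)

/-- Literals of a common clause, equal if the clause has one literal only. -/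
def Linked (φ : Formula) (a b : Literal) : Prop :=
  (Clause.single a ∈ φ ∧ a = b) ∨ Clause.pair a b ∈ φ ∨ Clause.pair b a ∈ φ

theorem litAt_single (ψ : Formula) (a : Literal) (l : List Symb) :
    LitAt (ψ.encode ++ ((Clause.single a).encode ++ l)) (1 + ψ.encode.length) a := by
  refine ⟨.clauseEnd :: l, ?_, noBit_clauseEnd l⟩
  have := view_of_view_append (view_one (x := ψ.encode ++ ((Clause.single a).encode ++ l)))
  simpa [Clause.encode_single] using this

theorem view_pair (ψ : Formula) (a b : Literal) (l : List Symb) :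
    View (ψ.encode ++ ((Clause.pair a b).encode ++ l)) (1 + ψ.encode.length)
      (a.encode ++ (b.encode ++ (.clauseEnd :: l))) := by
  have := view_of_view_append (view_one (x := ψ.encode ++ ((Clause.pair a b).encode ++ l)))
  simpa [Clause.encode_pair] using this

theorem litAt_pair_left (ψ : Formula) (a b : Literal) (l : List Symb) :
    LitAt (ψ.encode ++ ((Clause.pair a b).encode ++ l)) (1 + ψ.encode.length) a :=
  ⟨_, view_pair ψ a b l, noBit_encode_append _ _⟩

theorem litAt_pair_right (ψ : Formula) (a b : Literal) (l : List Symb) :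
    LitAt (ψ.encode ++ ((Clause.pair a b).encode ++ l))
      (1 + ψ.encode.length + a.encode.length) b :=
  ⟨_, view_of_view_append (view_pair ψ a b l), noBit_clauseEnd _⟩

theorem Pick.exists_linked {φ : Formula} {p q : ℕ} (h : Pick φ.encode p q) :
    ∃ a b, LitAt φ.encode p a ∧ LitAt φ.encode q b ∧ Linked φ a b := by
  cases h with
  | single ψ a l e =>
    refine ⟨a, a, ?_, ?_, Or.inl ⟨Formula.mem_of_encode_eq e, rfl⟩⟩ <;> rw [e] <;>
      apply litAt_single
  | pair ψ a b l e =>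
    refine ⟨a, b, ?_, ?_, Or.inr (Or.inl (Formula.mem_of_encode_eq e))⟩ <;> rw [e]
    exacts [litAt_pair_left _ _ _ _, litAt_pair_right _ _ _ _]
  | swap ψ a b l e =>
    refine ⟨b, a, ?_, ?_, Or.inr (Or.inr (Formula.mem_of_encode_eq e))⟩ <;> rw [e]
    exacts [litAt_pair_right _ _ _ _, litAt_pair_left _ _ _ _]

theorem Linked.exists_pick {φ : Formula} {a b : Literal} (h : Linked φ a b) :
    ∃ p q, Pick φ.encode p q ∧ LitAt φ.encode p a ∧ LitAt φ.encode q b := by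
  have split : ∀ {C : Clause}, C ∈ φ → ∃ (ψ : Formula) (l : List Symb),
      φ.encode = ψ.encode ++ (C.encode ++ l) := by
    intro C hC
    obtain ⟨ψ, χ, rfl⟩ := List.append_of_mem hC
    exact ⟨ψ, Formula.encode χ, by rw [Formula.encode_append, Formula.encode_cons]⟩
  rcases h with ⟨h, rfl⟩ | h | h <;> obtain ⟨ψ, l, e⟩ := split h
  · refine ⟨_, _, .single ψ a l e, ?_, ?_⟩ <;> rw [e] <;> apply litAt_single
  · refine ⟨_, _, .pair ψ a b l e, ?_, ?_⟩ <;> rw [e]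
    exacts [litAt_pair_left _ _ _ _, litAt_pair_right _ _ _ _]
  · refine ⟨_, _, .swap ψ b a l e, ?_, ?_⟩ <;> rw [e]
    exacts [litAt_pair_right _ _ _ _, litAt_pair_left _ _ _ _]

/-- Finding two literals of a common clause. -/
theorem programmable_pick :
    Programmable fun x v v' =>
      ∃ p q, Pick x p q ∧ v' = Function.update (Function.update v 2 p) 3 q := by
  have reg (i : Fin 6) : ({[save i]} : Language (Instr Symb 6)).IsRegular :=
    Language.isRegular_singleton _
  have hE : (literalLang * {[Symb.clauseEnd]}).IsRegular :=
    isRegular_literalLang.mul (Language.isRegular_singleton _)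
  have two (i j : Fin 6) : ({[save i]} * (scan literalLang * ({[save j]} *
      scan (literalLang * {[Symb.clauseEnd]}))) : Language (Instr Symb 6)).IsRegular :=
    (reg i).mul ((isRegular_scan isRegular_literalLang).mul ((reg j).mul (isRegular_scan hE)))
  have mem_hE : ∀ {w : List Symb}, w ∈ literalLang * {[Symb.clauseEnd]} ↔
      ∃ a : Literal, w = a.encode ++ [.clauseEnd] := by
    intro w
    constructor
    · rintro ⟨_, h, _, rfl, rfl⟩
      obtain ⟨a, rfl⟩ := mem_literalLang.1 h
      exact ⟨a, rfl⟩
    · rintro ⟨a, rfl⟩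
      exact ⟨_, mem_literalLang.2 ⟨a, rfl⟩, _, rfl, rfl⟩
  have sem_two : ∀ {x : List Symb} {i j : Fin 6} {p : ℕ} {r : Fin 6 → ℕ} {l : List Symb}
      {s' : Store 6}, View x p l →
      (Sem ({[save i]} * (scan literalLang * ({[save j]} *
        scan (literalLang * {[Symb.clauseEnd]})))) x (p, r) s' ↔
      ∃ (a b : Literal) (l' : List Symb), l = (Clause.pair a b).encode ++ l' ∧
        s' = (p + (Clause.pair a b).encode.length,
          Function.update (Function.update r i p) j (p + a.encode.length))) := by
    intro x i j p r l s' hp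
    simp only [sem_mul, sem_instr, Step]
    constructor
    · rintro ⟨_, rfl, _, h1, _, rfl, h2⟩
      obtain ⟨u, hu, l1, rfl, rfl⟩ := (sem_scan hp).1 h1
      obtain ⟨a, rfl⟩ := mem_literalLang.1 hu
      obtain ⟨v, hv, l2, rfl, rfl⟩ := (sem_scan (view_of_view_append hp)).1 h2
      obtain ⟨b, rfl⟩ := mem_hE.1 hv
      exact ⟨a, b, l2, by simp [Clause.encode_pair], by simp [Clause.encode_pair, Nat.add_assoc]⟩
    · rintro ⟨a, b, l', rfl, rfl⟩
      rw [Clause.encode_pair, List.append_assoc] at hp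
      exact ⟨_, rfl, _, (sem_scan hp).2 ⟨_, mem_literalLang.2 ⟨a, rfl⟩, _, rfl, rfl⟩, _, rfl,
        (sem_scan (view_of_view_append hp)).2 ⟨_, mem_hE.2 ⟨b, rfl⟩, l', rfl,
          by simp [Clause.encode_pair, Nat.add_assoc]⟩⟩
  -- The program skips a guessed number of clauses. Its three alternatives then read one clause and
  -- match the three constructors of `Pick`, saving the positions of its literals in registers 2 and
  -- 3.
  refine ⟨home * ({[right]} * (scan (KStar.kstar clauseLang) *
    (({[save 2]} * ({[save 3]} * scan (literalLang * {[.clauseEnd]}))) +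
    (({[save 2]} * (scan literalLang * ({[save 3]} * scan (literalLang * {[.clauseEnd]})))) +
    ({[save 3]} * (scan literalLang * ({[save 2]} * scan (literalLang * {[.clauseEnd]})))))))),
    isRegular_home.mul ((Language.isRegular_singleton _).mul
      ((isRegular_scan isRegular_clauseLang.kstar).mul
        (((reg 2).mul ((reg 3).mul (isRegular_scan hE))).add ((two 2 3).add (two 3 2))))), ?_⟩
  intro x s v'
  rw [show (∃ s', _ ∧ visible s' = v') ↔ ∃ (ψ : Formula) (l : List Symb), x = ψ.encode ++ l ∧
    ∃ s', Sem (({[save 2]} * ({[save 3]} * scan (literalLang * {[.clauseEnd]}))) +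
    (({[save 2]} * (scan literalLang * ({[save 3]} * scan (literalLang * {[.clauseEnd]})))) +
    ({[save 3]} * (scan literalLang * ({[save 2]} * scan (literalLang * {[.clauseEnd]})))))) x
      (1 + ψ.encode.length, s.2) s' ∧ visible s' = v' from ?_]
  · have e2 : ∀ (h : ℕ) (r : Fin 6 → ℕ) (p : ℕ), visible (h, Function.update r 2 p) =
      Function.update (visible (h, r)) 2 p := fun h r p => visible_update h r 2 p
    have e3 : ∀ (h : ℕ) (r : Fin 6 → ℕ) (p : ℕ), visible (h, Function.update r 3 p) =
      Function.update (visible (h, r)) 3 p := fun h r p => visible_update h r 3 p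
    constructor
    · rintro ⟨ψ, l, hx, s', hs, rfl⟩
      have hv : View x (1 + ψ.encode.length) l := by
        have := view_one (x := x)
        rw [hx] at this ⊢
        exact view_of_view_append this
      rcases sem_add.1 hs with hs | hs
      · simp only [sem_mul, sem_instr, Step] at hs
        obtain ⟨_, rfl, _, rfl, hs⟩ := hs
        obtain ⟨u, hu, l', rfl, rfl⟩ := (sem_scan hv).1 hs
        obtain ⟨a, rfl⟩ := mem_hE.1 hu
        exact ⟨_, _, .single ψ a l' (by rw [Clause.encode_single]; exact hx), by rw [e3, e2]; rfl⟩
      · rcases sem_add.1 hs with hs | hs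
        · obtain ⟨a, b, l', rfl, rfl⟩ := (sem_two hv).1 hs
          exact ⟨_, _, .pair ψ a b l' hx, by rw [e3, e2]; rfl⟩
        · obtain ⟨a, b, l', rfl, rfl⟩ := (sem_two hv).1 hs
          refine ⟨_, _, .swap ψ a b l' hx, ?_⟩
          rw [e2, e3, Function.update_comm (by decide)]
          rfl
    · rintro ⟨p, q, h, rfl⟩
      have hv : ∀ {ψ : Formula} {l : List Symb}, x = ψ.encode ++ l →
          View x (1 + ψ.encode.length) l := by
        intro ψ l hx
        have := view_one (x := x)
        rw [hx] at this ⊢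
        exact view_of_view_append this
      cases h with
      | single ψ a l e =>
        refine ⟨ψ, _, e, _, sem_add.2 (Or.inl (sem_mul.2 ⟨_, sem_instr.2 rfl, sem_mul.2
          ⟨_, sem_instr.2 rfl, (sem_scan (hv e)).2 ⟨_, mem_hE.2 ⟨a, rfl⟩, l, ?_, rfl⟩⟩⟩)), ?_⟩
        · rw [Clause.encode_single]
        · dsimp only
          rw [e3, e2]
          rfl
      | pair ψ a b l e =>
        refine ⟨ψ, _, e, _, sem_add.2 (Or.inr (sem_add.2 (Or.inl
          ((sem_two (hv e)).2 ⟨a, b, l, rfl, rfl⟩)))), ?_⟩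
        rw [e3, e2]
        rfl
      | swap ψ a b l e =>
        refine ⟨ψ, _, e, _, sem_add.2 (Or.inr (sem_add.2 (Or.inr
          ((sem_two (hv e)).2 ⟨a, b, l, rfl, rfl⟩)))), ?_⟩
        rw [e2, e3, Function.update_comm (by decide)]
        rfl
  · constructor
    · rintro ⟨s', hs, h⟩
      obtain ⟨_, h1, hs⟩ := sem_mul.1 hs
      rw [sem_home] at h1
      subst h1
      obtain ⟨_, h1, hs⟩ := sem_mul.1 hs
      obtain ⟨-, rfl⟩ := sem_instr.1 h1
      obtain ⟨_, h1, hs⟩ := sem_mul.1 hs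
      obtain ⟨u, hu, l, hx, rfl⟩ := (sem_scan view_one).1 h1
      obtain ⟨ψ, rfl⟩ := mem_kstar_clauseLang.1 hu
      exact ⟨ψ, l, hx, s', hs, h⟩
    · rintro ⟨ψ, l, hx, s', hs, h⟩
      exact ⟨s', sem_mul.2 ⟨_, sem_home.2 rfl, sem_mul.2 ⟨_, sem_instr.2 ⟨by simp, rfl⟩,
        sem_mul.2 ⟨_, (sem_scan view_one).2
          ⟨_, mem_kstar_clauseLang.2 ⟨ψ, rfl⟩, l, hx, rfl⟩, hs⟩⟩⟩, h⟩

end SpaceBounded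

/-! ## Comparison of literals -/

namespace SpaceBounded

open Instr

/-- Read a symbol at each of the positions stored in the auxiliary registers and advance these. -/
def readBoth (a b : Symb) : Language (Instr Symb 6) :=
  goto 4 * ({[sym (.letter a)]} * ({[right]} * ({[save 4]} *
    (goto 5 * ({[sym (.letter b)]} * ({[right]} * {[save 5]}))))))

/-- Test that there is no digit at the position stored in a register. -/
def testNoBit (i : Fin 6) : Language (Instr Symb 6) :=
  goto i * (({[sym (.letter .pos)]} + {[sym (.letter .neg)]}) +
    ({[sym (.letter .clauseEnd)]} + {[sym .rightEnd]}))

theorem isRegular_readBoth (a b : Symb) : (readBoth a b).IsRegular :=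
  (isRegular_goto _).mul ((Language.isRegular_singleton _).mul ((Language.isRegular_singleton _).mul
    ((Language.isRegular_singleton _).mul ((isRegular_goto _).mul
      ((Language.isRegular_singleton _).mul ((Language.isRegular_singleton _).mul
        (Language.isRegular_singleton _)))))))

theorem isRegular_testNoBit (i : Fin 6) : (testNoBit i).IsRegular :=
  (isRegular_goto _).mul (((Language.isRegular_singleton _).add (Language.isRegular_singleton _)).add
    ((Language.isRegular_singleton _).add (Language.isRegular_singleton _)))

variable {x : List Symb}

theorem le_of_inputAt_eq_letter {p : ℕ} {a : Symb} (h : Machine.inputAt x p = .letter a) :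
    p ≤ x.length := by
  by_contra hp
  rw [inputAt_eq_rightEnd.2 (by omega)] at h
  simp at h

theorem sem_readBoth {a b : Symb} {s s' : Store 6} :
    Sem (readBoth a b) x s s' ↔ Machine.inputAt x (s.2 4) = .letter a ∧
      Machine.inputAt x (s.2 5) = .letter b ∧ s' = (s.2 5 + 1,
        Function.update (Function.update s.2 4 (s.2 4 + 1)) 5 (s.2 5 + 1)) := by
  have h5 : ∀ n, Function.update s.2 4 n 5 = s.2 5 := fun n =>
    Function.update_of_ne (by decide) _ _
  simp only [readBoth, sem_mul, sem_goto, sem_instr, Step]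
  constructor
  · rintro ⟨_, ⟨-, rfl⟩, _, ⟨h1, rfl⟩, _, ⟨-, rfl⟩, _, rfl, _, ⟨-, rfl⟩, _, ⟨h2, rfl⟩, _, ⟨-, rfl⟩,
      rfl⟩
    dsimp only at h1 h2 ⊢
    rw [h5] at h2
    exact ⟨h1, h2, by rw [h5]⟩
  · rintro ⟨h1, h2, rfl⟩
    have h3 := le_of_inputAt_eq_letter h1
    have h4 := le_of_inputAt_eq_letter h2
    refine ⟨_, ⟨by omega, rfl⟩, _, ⟨h1, rfl⟩, _, ⟨h3, rfl⟩, _, rfl, _, ⟨?_, rfl⟩, _, ⟨?_, rfl⟩, _,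
      ⟨?_, rfl⟩, ?_⟩ <;> dsimp only <;> rw [h5]
    · omega
    · exact h2
    · exact h4

theorem visible_readBoth {a b : Symb} {s s' : Store 6} (h : Sem (readBoth a b) x s s') :
    visible s' = visible s := by
  rw [(sem_readBoth.1 h).2.2, visible_update_five, visible_update_four]
  rfl

theorem sem_readBoth_iff {a b : Symb} {s s' : Store 6} {c d : Symb} {l l' : List Symb}
    (h4 : View x (s.2 4) (c :: l)) (h5 : View x (s.2 5) (d :: l')) :
    Sem (readBoth a b) x s s' ↔ a = c ∧ b = d ∧ s' = (s.2 5 + 1,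
        Function.update (Function.update s.2 4 (s.2 4 + 1)) 5 (s.2 5 + 1)) := by
  rw [sem_readBoth, (view_cons_iff.1 h4).1, (view_cons_iff.1 h5).1]
  simp [eq_comm]

theorem view_readBoth {a b : Symb} {s s' : Store 6} (h : Sem (readBoth a b) x s s') :
    ∃ l l', View x (s.2 4) (a :: l) ∧ View x (s.2 5) (b :: l') ∧
      View x (s'.2 4) l ∧ View x (s'.2 5) l' := by
  obtain ⟨h1, h2, rfl⟩ := sem_readBoth.1 h
  obtain ⟨l, hl⟩ := exists_view (Nat.succ_pos _) (Nat.succ_le_succ (le_of_inputAt_eq_letter h1))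
  obtain ⟨l', hl'⟩ := exists_view (Nat.succ_pos _) (Nat.succ_le_succ (le_of_inputAt_eq_letter h2))
  refine ⟨l, l', view_cons_iff.2 ⟨h1, hl⟩, view_cons_iff.2 ⟨h2, hl'⟩, ?_, ?_⟩
  · dsimp only
    rw [Function.update_of_ne (by decide), Function.update_self]
    exact hl
  · dsimp only
    rw [Function.update_self]
    exact hl'

theorem exists_sem_readBoth {a b : Symb} {s : Store 6} {l l' : List Symb}
    (h4 : View x (s.2 4) (a :: l)) (h5 : View x (s.2 5) (b :: l')) :
    ∃ s', Sem (readBoth a b) x s s' ∧ View x (s'.2 4) l ∧ View x (s'.2 5) l' := by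
  have h := (sem_readBoth_iff h4 h5).2 ⟨rfl, rfl, rfl⟩
  obtain ⟨m, m', h6, h7, h8, h9⟩ := view_readBoth h
  obtain ⟨-, rfl⟩ := List.cons.inj (h4.unique h6)
  obtain ⟨-, rfl⟩ := List.cons.inj (h5.unique h7)
  exact ⟨_, h, h8, h9⟩

/-- Read a common string of digits. -/
def readBits : Language (Instr Symb 6) := KStar.kstar (∑ b : Bool, readBoth (bit b) (bit b))

theorem isRegular_readBits : readBits.IsRegular :=
  (Language.isRegular_sum fun _ => isRegular_readBoth _ _).kstar

theorem view_readBits {s s' : Store 6} (h : Sem readBits x s s') {l l' : List Symb}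
    (h4 : View x (s.2 4) l) (h5 : View x (s.2 5) l') : visible s' = visible s ∧
    ∃ (u : List Bool) (m m' : List Symb), l = u.map bit ++ m ∧ l' = u.map bit ++ m' ∧
      View x (s'.2 4) m ∧ View x (s'.2 5) m' := by
  have h := sem_kstar.1 h
  induction h using Relation.ReflTransGen.head_induction_on generalizing l l' with
  | refl => exact ⟨rfl, [], l, l', rfl, rfl, h4, h5⟩
  | head h1 h2 ih =>
    obtain ⟨b, -, h3⟩ := sem_sum.1 h1
    obtain ⟨k, k', h6, h7, h8, h9⟩ := view_readBoth h3
    obtain rfl := h4.unique h6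
    obtain rfl := h5.unique h7
    obtain ⟨h10, u, m, m', rfl, rfl, h11, h12⟩ := ih (sem_kstar.2 h2) h8 h9
    exact ⟨h10.trans (visible_readBoth h3), b :: u, m, m', rfl, rfl, h11, h12⟩

theorem exists_sem_readBits {s : Store 6} (u : List Bool) {m m' : List Symb}
    (h4 : View x (s.2 4) (u.map bit ++ m)) (h5 : View x (s.2 5) (u.map bit ++ m')) :
    ∃ s', Sem readBits x s s' ∧ View x (s'.2 4) m ∧ View x (s'.2 5) m' := by
  induction u generalizing s with
  | nil => exact ⟨s, sem_kstar.2 .refl, h4, h5⟩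
  | cons b u ih =>
    obtain ⟨t, h1, h2, h3⟩ := exists_sem_readBoth h4 h5
    obtain ⟨s', h6, h7, h8⟩ := ih h2 h3
    exact ⟨s', sem_kstar.2 (.head (sem_sum.2 ⟨b, Finset.mem_univ _, h1⟩) (sem_kstar.1 h6)), h7, h8⟩

theorem noBit_iff {p : ℕ} {l : List Symb} (h : View x p l) :
    NoBit l ↔ (Machine.inputAt x p = .letter .pos ∨ Machine.inputAt x p = .letter .neg) ∨
      (Machine.inputAt x p = .letter .clauseEnd ∨ Machine.inputAt x p = .rightEnd) := by
  cases l with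
  | nil => simp [noBit_nil, inputAt_eq_rightEnd, view_nil_iff.1 h]
  | cons a l =>
    rw [(view_cons_iff.1 h).1]
    have e : NoBit (a :: l) ↔ ∀ b, a ≠ bit b := by simp [NoBit]
    rw [e]
    cases a <;> simp [bit]

theorem sem_testNoBit {i : Fin 6} {s s' : Store 6} {l : List Symb} (h : View x (s.2 i) l) :
    Sem (testNoBit i) x s s' ↔ NoBit l ∧ s' = (s.2 i, s.2) := by
  rw [noBit_iff h]
  simp only [testNoBit, sem_mul, sem_add, sem_goto, sem_instr, Step]
  have := h.le
  constructor
  · rintro ⟨_, ⟨-, rfl⟩, h1⟩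
    dsimp only at h1
    tauto
  · rintro ⟨h1, rfl⟩
    refine ⟨_, ⟨this, rfl⟩, ?_⟩
    dsimp only
    tauto

/-- Comparing literals: they have the same variable, and their signs are related as prescribed. -/
theorem programmable_compare (i j : Fin 4) (ρ : Bool → Bool → Bool) :
    Programmable fun x v v' => (∃ a b, LitAt x (v i) a ∧ LitAt x (v j) b ∧ a.var = b.var ∧
      ρ a.positive b.positive = true) ∧ v' = v := by
  refine ⟨goto (i.castAdd 2) * ({[save 4]} * (goto (j.castAdd 2) * ({[save 5]} *
    ((∑ c ∈ Finset.univ.filter (fun c : Bool × Bool => ρ c.1 c.2 = true),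
      readBoth (sgn c.1) (sgn c.2)) * (readBits * (testNoBit 4 * testNoBit 5)))))),
    (isRegular_goto _).mul ((Language.isRegular_singleton _).mul ((isRegular_goto _).mul
      ((Language.isRegular_singleton _).mul ((Language.isRegular_sum fun _ =>
        isRegular_readBoth _ _).mul (isRegular_readBits.mul
          ((isRegular_testNoBit _).mul (isRegular_testNoBit _))))))), fun x s v' => ?_⟩
  have e1 : ∀ n, Function.update s.2 4 n (j.castAdd 2) = s.2 (j.castAdd 2) := by
    intro n
    refine Function.update_of_ne ?_ _ _
    revert j; decide
  simp only [sem_mul, sem_goto, sem_instr, Step]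
  constructor
  · rintro ⟨s', ⟨_, ⟨-, rfl⟩, _, rfl, _, ⟨-, rfl⟩, _, rfl, t, h1, t', h2, t'', h3, h4⟩, rfl⟩
    obtain ⟨⟨c, d⟩, hc, h1⟩ := sem_sum.1 h1
    have hρ := (Finset.mem_filter.1 hc).2
    obtain ⟨l, l', h6, h7, h8, h9⟩ := view_readBoth h1
    obtain ⟨h10, u, m, m', rfl, rfl, h11, h12⟩ := view_readBits h2 h8 h9
    rw [sem_testNoBit h11] at h3
    obtain ⟨h13, rfl⟩ := h3
    rw [sem_testNoBit (s := (t'.2 4, t'.2)) h12] at h4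
    obtain ⟨h14, rfl⟩ := h4
    dsimp only at h6 h7
    rw [Function.update_of_ne (by decide), Function.update_self] at h6
    rw [Function.update_self, e1] at h7
    refine ⟨⟨⟨u, c⟩, ⟨u, d⟩, ⟨m, h6, h13⟩, ⟨m', h7, h14⟩, rfl, hρ⟩, ?_⟩
    calc visible t' = visible t := h10
      _ = _ := visible_readBoth h1
      _ = visible s := by rw [visible_update_five, visible_update_four]; rfl
  · rintro ⟨⟨⟨u, c⟩, ⟨v, d⟩, h1, h2, rfl, hρ⟩, rfl⟩
    have hi := h1.le
    have hj := h2.le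
    obtain ⟨m, h3, h4⟩ := h1
    obtain ⟨m', h5, h6⟩ := h2
    obtain ⟨t, h7, h8, h9⟩ := exists_sem_readBoth (x := x) (a := sgn c) (b := sgn d)
      (s := (s.2 (j.castAdd 2), Function.update (Function.update s.2 4 (s.2 (i.castAdd 2))) 5
        (s.2 (j.castAdd 2)))) (l := u.map bit ++ m) (l' := u.map bit ++ m')
      (by dsimp only; rw [Function.update_of_ne (by decide), Function.update_self]; exact h3)
      (by dsimp only; rw [Function.update_self]; exact h5)
    obtain ⟨t', h10, h11, h12⟩ := exists_sem_readBits u h8 h9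
    refine ⟨(t'.2 5, t'.2), ⟨_, ⟨hi, rfl⟩, _, rfl, _, ⟨?_, rfl⟩, _, rfl, t, ?_, t', h10, _,
      (sem_testNoBit h11).2 ⟨h4, rfl⟩, (sem_testNoBit (s := (t'.2 4, t'.2)) h12).2 ⟨h6, rfl⟩⟩, ?_⟩
    · dsimp only
      rw [e1]
      exact hj
    · refine sem_sum.2 ⟨(c, d), Finset.mem_filter.2 ⟨Finset.mem_univ _, hρ⟩, ?_⟩
      dsimp only
      rw [e1]
      exact h7
    · obtain ⟨h13, -⟩ := view_readBits h10 h8 h9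
      calc visible t' = visible t := h13
        _ = _ := visible_readBoth h7
        _ = visible s := by rw [visible_update_five, visible_update_four]; rfl

end SpaceBounded

/-! ## Satisfiability of 2CNF formulas -/

namespace SpaceBounded

open Instr

/-- The negation of a literal. -/
def Literal.not (a : Literal) : Literal := ⟨a.var, !a.positive⟩

theorem Literal.not_not (a : Literal) : a.not.not = a := by
  cases a
  simp [Literal.not]

theorem Literal.eq_not {a b : Literal} (h : a.var = b.var) (h' : a.positive ≠ b.positive) :
    b = a.not := by
  obtain ⟨u, _ | _⟩ := a <;> obtain ⟨v, _ | _⟩ := b <;> simp_all [Literal.not]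

theorem Literal.eq_of_var_eq {a b : Literal} (h : a.var = b.var) (h' : a.positive = b.positive) :
    a = b := by
  cases a
  cases b
  simp_all

theorem Linked.symm {φ : Formula} {a b : Literal} (h : Linked φ a b) : Linked φ b a := by
  rcases h with ⟨h, rfl⟩ | h | h
  exacts [Or.inl ⟨h, rfl⟩, Or.inr (Or.inr h), Or.inr (Or.inl h)]

/-- The edges of the implication graph. -/
def Edge (φ : Formula) (a b : Literal) : Prop := Linked φ a.not b

/-- A clause is symmetric in its literals, so each clause yields an edge together with its
contrapositive. -/
theorem Edge.contrapose {φ : Formula} {a b : Literal} (h : Edge φ a b) : Edge φ b.not a.not := by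
  rw [Edge, Literal.not_not]
  exact Linked.symm h

/-- Implication by a chain of clauses. -/
abbrev Implies (φ : Formula) : Literal → Literal → Prop := Relation.ReflTransGen (Edge φ)

theorem Implies.contrapose {φ : Formula} {a b : Literal} (h : Implies φ a b) :
    Implies φ b.not a.not := by
  induction h with
  | refl => rfl
  | tail _ h ih => exact .head h.contrapose ih

theorem exists_true_of_linked {φ : Formula} {a b : Literal} {σ : List Bool → Bool}
    (hσ : ∀ C ∈ φ, ∃ a ∈ C.literals, σ a.var = a.positive) (h : Linked φ a b) :
    σ a.var = a.positive ∨ σ b.var = b.positive := by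
  rcases h with ⟨h, rfl⟩ | h | h <;> obtain ⟨c, hc, h'⟩ := hσ _ h <;>
    simp only [Clause.literals, List.mem_cons, List.not_mem_nil, or_false] at hc
  · exact Or.inl (hc ▸ h')
  · rcases hc with rfl | rfl
    exacts [Or.inl h', Or.inr h']
  · rcases hc with rfl | rfl
    exacts [Or.inr h', Or.inl h']

theorem Implies.true_of_true {φ : Formula} {a b : Literal} {σ : List Bool → Bool}
    (hσ : ∀ C ∈ φ, ∃ a ∈ C.literals, σ a.var = a.positive) (h : Implies φ a b)
    (ha : σ a.var = a.positive) : σ b.var = b.positive := by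
  induction h with
  | refl => exact ha
  | @tail b c _ h ih =>
    refine (exists_true_of_linked hσ h).resolve_left fun h' => ?_
    change σ b.var = !b.positive at h'
    rw [ih] at h'
    simp at h'

/-- A formula is satisfiable if no literal and its negation imply each other. -/
theorem satisfiable_of_forall {φ : Formula}
    (h : ∀ a : Literal, ¬ (Implies φ a a.not ∧ Implies φ a.not a)) : φ.Satisfiable := by
  -- Consistent sets of literals closed under implication. There are infinitely many literals, so a
  -- maximal one comes from Zorn's lemma; it will contain each literal or its negation and thus be a
  -- truth assignment.
  let F : Set (Set Literal) :=
    {S | (∀ a ∈ S, ∀ b, Edge φ a b → b ∈ S) ∧ ∀ a ∈ S, a.not ∉ S}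
  obtain ⟨S, hS⟩ : ∃ S, Maximal (· ∈ F) S := by
    refine zorn_subset F fun c hc hchain => ⟨⋃₀ c, ⟨?_, ?_⟩, fun s hs => Set.subset_sUnion_of_mem hs⟩
    · rintro a ⟨s, hs, ha⟩ b hab
      exact ⟨s, hs, (hc hs).1 a ha b hab⟩
    · rintro a ⟨s, hs, ha⟩ ⟨t, ht, hat⟩
      rcases hchain.total hs ht with hst | hst
      · exact (hc ht).2 a (hst ha) hat
      · exact (hc hs).2 a ha (hst hat)
  obtain ⟨⟨hcl, hcon⟩, hmax⟩ := hS
  have hcl' : ∀ {a b}, a ∈ S → Implies φ a b → b ∈ S := by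
    intro a b ha hab
    induction hab with
    | refl => exact ha
    | tail _ h ih => exact hcl _ ih _ h
  have extend : ∀ b : Literal, b.not ∉ S → ¬ Implies φ b b.not → b ∈ S := by
    intro b hb hbb
    have hT : S ∪ {c | Implies φ b c} ∈ F := by
      -- If `b` implied the negation of a member `c`, then by contraposition `c` would imply
      -- `b.not`, which closedness would put into `S`.
      have cross : ∀ {c}, c ∈ S → ¬ Implies φ b c.not := by
        intro c hc h1
        have := h1.contrapose
        rw [Literal.not_not] at this
        exact hb (hcl' hc this)
      refine ⟨?_, ?_⟩
      · rintro a (ha | ha) c hac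
        exacts [Or.inl (hcl a ha c hac), Or.inr (Relation.ReflTransGen.tail ha hac)]
      · rintro a (ha | ha) (ha' | ha')
        · exact hcon a ha ha'
        · exact cross ha ha'
        · exact cross ha' (by rw [Literal.not_not]; exact ha)
        · have h1 := Implies.contrapose ha'
          rw [Literal.not_not] at h1
          exact hbb (Relation.ReflTransGen.trans ha h1)
    exact hmax hT Set.subset_union_left (Or.inr .refl)
  -- If both were missing, maximality would leave only the case that `a` and `a.not` imply each
  -- other, which is excluded.
  have total : ∀ a : Literal, a ∈ S ∨ a.not ∈ S := by
    intro a
    by_contra hcon'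
    push Not at hcon'
    refine h a ⟨?_, ?_⟩
    · by_contra h1
      exact hcon'.1 (extend a hcon'.2 h1)
    · by_contra h1
      refine hcon'.2 (extend a.not (by rw [Literal.not_not]; exact hcon'.1) ?_)
      rwa [Literal.not_not]
  classical
  have truth : ∀ a ∈ S, decide ((⟨a.var, true⟩ : Literal) ∈ S) = a.positive := by
    rintro ⟨v, _ | _⟩ ha
    · simpa [Literal.not] using hcon _ ha
    · simpa using ha
  have key : ∀ a b : Literal, Linked φ a b → a ∈ S ∨ b ∈ S := by
    intro a b hab
    refine (total a).imp_right fun ha => hcl _ ha b ?_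
    rw [Edge, Literal.not_not]
    exact hab
  refine ⟨fun v => decide ((⟨v, true⟩ : Literal) ∈ S), fun C hC => ?_⟩
  cases C with
  | single a =>
    refine ⟨a, by simp [Clause.literals], truth a ?_⟩
    simpa using key a a (Or.inl ⟨hC, rfl⟩)
  | pair a b =>
    rcases key a b (Or.inr (Or.inl hC)) with h | h
    exacts [⟨a, by simp [Clause.literals], truth a h⟩, ⟨b, by simp [Clause.literals], truth b h⟩]

/-- The clause `Linked φ b a` guarantees that `a` itself is written somewhere in the formula, so
that a program can point to it. -/
theorem not_satisfiable_iff {φ : Formula} :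
    ¬ φ.Satisfiable ↔ ∃ a b : Literal, Linked φ b a ∧ Implies φ a a.not ∧ Implies φ a.not a := by
  constructor
  · intro h
    by_contra hcon
    refine h (satisfiable_of_forall fun a ⟨h1, h2⟩ => hcon ?_)
    -- A literal differs from its negation, so the path to `a` has a last edge, and the clause of
    -- that edge contains `a`.
    rcases Relation.ReflTransGen.cases_tail h2 with h3 | ⟨b, -, h3⟩
    · have := congrArg Literal.positive h3
      simp [Literal.not] at this
    · exact ⟨a, b.not, h3, h1, h2⟩
  · rintro ⟨a, -, -, h1, h2⟩ ⟨σ, hσ⟩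
    have h3 : σ a.var = a.positive → σ a.var = !a.positive := h1.true_of_true hσ
    have h4 : σ a.var = !a.positive → σ a.var = a.positive := h2.true_of_true hσ
    revert h3 h4
    cases σ a.var <;> cases a.positive <;> simp

/-! ### A pointer program for unsatisfiability -/

/-- One step in the implication graph, from the literal at the position in register `1`. -/
def EdgeStep (x : List Symb) : (Fin 4 → ℕ) → (Fin 4 → ℕ) → Prop :=
  Relation.Comp
    (fun v v' => ∃ p q, Pick x p q ∧ v' = Function.update (Function.update v 2 p) 3 q)
    (Relation.Comp
      (fun v v' => (∃ a b, LitAt x (v 1) a ∧ LitAt x (v 2) b ∧ a.var = b.var ∧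
        (a.positive != b.positive) = true) ∧ v' = v)
      (fun v v' => v 3 ≤ x.length + 1 ∧ v' = Function.update v 1 (v 3)))

theorem programmable_edgeStep : Programmable EdgeStep :=
  programmable_pick.comp ((programmable_compare 1 2 bne).comp (programmable_assign 1 3))

/-- Choice of a literal, whose position is stored in the registers `0` and `1`. -/
def ChooseLiteral (x : List Symb) : (Fin 4 → ℕ) → (Fin 4 → ℕ) → Prop :=
  Relation.Comp
    (fun v v' => ∃ p q, Pick x p q ∧ v' = Function.update (Function.update v 2 p) 3 q)
    (Relation.Comp
      (fun v v' => v 3 ≤ x.length + 1 ∧ v' = Function.update v 0 (v 3))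
      (fun v v' => v 3 ≤ x.length + 1 ∧ v' = Function.update v 1 (v 3)))

theorem programmable_chooseLiteral : Programmable ChooseLiteral :=
  programmable_pick.comp ((programmable_assign 0 3).comp (programmable_assign 1 3))

/-- Search for a literal and its negation that imply each other. -/
def FindCycle (x : List Symb) : (Fin 4 → ℕ) → (Fin 4 → ℕ) → Prop :=
  Relation.Comp (ChooseLiteral x) (Relation.Comp (Relation.ReflTransGen (EdgeStep x))
    (Relation.Comp
      (fun v v' => (∃ a b, LitAt x (v 0) a ∧ LitAt x (v 1) b ∧ a.var = b.var ∧
        (a.positive != b.positive) = true) ∧ v' = v)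
      (Relation.Comp (Relation.ReflTransGen (EdgeStep x))
        (fun v v' => (∃ a b, LitAt x (v 0) a ∧ LitAt x (v 1) b ∧ a.var = b.var ∧
          (a.positive == b.positive) = true) ∧ v' = v))))

theorem programmable_findCycle : Programmable FindCycle :=
  programmable_chooseLiteral.comp (programmable_edgeStep.reflTransGen.comp
    ((programmable_compare 0 1 bne).comp (programmable_edgeStep.reflTransGen.comp
      (programmable_compare 0 1 (· == ·)))))

section Correctness

variable {φ : Formula} {v v' : Fin 4 → ℕ} {a c : Literal}

/-- A clause with literals `b` and `c` gives the edge from `b.not` to `c`; the comparison of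
registers 1 and 2 checks that the current literal is `b.not`. Register 0 keeps the start of the
search. -/
theorem EdgeStep.exists_edge (h : EdgeStep φ.encode v v') (ha : LitAt φ.encode (v 1) a) :
    v' 0 = v 0 ∧ ∃ c, Edge φ a c ∧ LitAt φ.encode (v' 1) c := by
  obtain ⟨_, ⟨p, q, hpq, rfl⟩, _, ⟨⟨a', b, h1, h2, h3, h4⟩, rfl⟩, -, rfl⟩ := h
  have e1 : Function.update (Function.update v 2 p) 3 q 1 = v 1 := rfl
  have e2 : Function.update (Function.update v 2 p) 3 q 2 = p := rfl
  rw [e1] at h1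
  rw [e2] at h2
  obtain rfl := ha.unique h1
  obtain ⟨b', c, h5, h6, h7⟩ := hpq.exists_linked
  obtain rfl := h2.unique h5
  refine ⟨rfl, c, ?_, h6⟩
  rw [Edge, ← Literal.eq_not h3 (by simpa using h4)]
  exact h7

theorem Edge.exists_edgeStep (h : Edge φ a c) (ha : LitAt φ.encode (v 1) a) :
    ∃ v', EdgeStep φ.encode v v' ∧ v' 0 = v 0 ∧ LitAt φ.encode (v' 1) c := by
  obtain ⟨p, q, hpq, h1, h2⟩ := Linked.exists_pick h
  exact ⟨_, ⟨_, ⟨p, q, hpq, rfl⟩, _, ⟨⟨a, a.not, ha, h1, rfl, by simp [Literal.not]⟩, rfl⟩, h2.le,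
    rfl⟩, rfl, h2⟩

theorem implies_of_reflTransGen (h : Relation.ReflTransGen (EdgeStep φ.encode) v v')
    (ha : LitAt φ.encode (v 1) a) :
    v' 0 = v 0 ∧ ∃ c, Implies φ a c ∧ LitAt φ.encode (v' 1) c := by
  induction h with
  | refl => exact ⟨rfl, a, .refl, ha⟩
  | tail _ h ih =>
    obtain ⟨h1, b, h2, h3⟩ := ih
    obtain ⟨h4, c, h5, h6⟩ := h.exists_edge h3
    exact ⟨h4.trans h1, c, h2.tail h5, h6⟩

theorem Implies.exists_reflTransGen (h : Implies φ a c) (ha : LitAt φ.encode (v 1) a) :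
    ∃ v', Relation.ReflTransGen (EdgeStep φ.encode) v v' ∧ v' 0 = v 0 ∧
      LitAt φ.encode (v' 1) c := by
  induction h with
  | refl => exact ⟨v, .refl, rfl, ha⟩
  | tail _ h ih =>
    obtain ⟨w, h1, h2, h3⟩ := ih
    obtain ⟨v', h4, h5, h6⟩ := h.exists_edgeStep h3
    exact ⟨v', h1.tail h4, h5.trans h2, h6⟩

/-- Registers 0 and 1 start at one occurrence of a literal; the walk of register 1 must meet its
negation and later the literal again. The final occurrence may be another one, so literals rather
than positions are compared. -/
theorem exists_findCycle_iff : (∃ v', FindCycle φ.encode v v') ↔ ¬ φ.Satisfiable := by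
  rw [not_satisfiable_iff]
  constructor
  · rintro ⟨v', v₁, h1, v₂, h2, _, ⟨⟨a, b, h3, h4, h5, h6⟩, rfl⟩, v₃, h7, ⟨a', b', h8, h9, h10, h11⟩,
      rfl⟩
    obtain ⟨_, ⟨p, q, hpq, rfl⟩, _, ⟨-, rfl⟩, -, rfl⟩ := h1
    obtain ⟨d, c, -, hq, hl⟩ := hpq.exists_linked
    obtain ⟨e1, b₁, h12, h13⟩ := implies_of_reflTransGen h2 hq
    obtain ⟨e2, b₂, h14, h15⟩ := implies_of_reflTransGen h7 h13
    rw [e1] at h3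
    rw [e2, e1] at h8
    obtain rfl := h3.unique hq
    obtain rfl := h8.unique hq
    obtain rfl := h4.unique h13
    obtain rfl := h9.unique h15
    obtain rfl := Literal.eq_not h5 (by simpa using h6)
    obtain rfl := Literal.eq_of_var_eq h10 (by simpa using h11)
    exact ⟨_, d, hl, h12, h14⟩
  · rintro ⟨a, b, hl, h1, h2⟩
    obtain ⟨p, q, hpq, -, hq⟩ := hl.exists_pick
    let v₁ := Function.update (Function.update (Function.update (Function.update v 2 p) 3 q) 0 q) 1 q
    have hv₁ : ChooseLiteral φ.encode v v₁ := ⟨_, ⟨p, q, hpq, rfl⟩, _, ⟨hq.le, rfl⟩, hq.le, rfl⟩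
    have hv0 : v₁ 0 = q := rfl
    have hv1 : v₁ 1 = q := rfl
    obtain ⟨v₂, h3, h4, h5⟩ := h1.exists_reflTransGen (v := v₁) hq
    obtain ⟨v₃, h6, h7, h8⟩ := h2.exists_reflTransGen h5
    refine ⟨v₃, v₁, hv₁, v₂, h3, v₂, ⟨⟨a, a.not, ?_, h5, rfl, ?_⟩, rfl⟩, v₃, h6,
      ⟨a, a, ?_, h8, rfl, ?_⟩, rfl⟩
    · rw [h4, hv0]
      exact hq
    · simp [Literal.not]
    · rw [h7, h4, hv0]
      exact hq
    · simp

end Correctness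

/-! ### A pointer program for counting occurrences -/

/-- The longest string of digits at the beginning. -/
def takeBits : List Symb → List Bool
  | .zero :: l => false :: takeBits l
  | .one :: l => true :: takeBits l
  | _ => []

/-- The variables of the literals in a string. -/
def names : List Symb → List (List Bool)
  | [] => []
  | .pos :: l => takeBits l :: names l
  | .neg :: l => takeBits l :: names l
  | _ :: l => names l

theorem takeBits_append (u : List Bool) {l : List Symb} (h : NoBit l) :
    takeBits (u.map bit ++ l) = u := by
  induction u with
  | nil =>
    match l with
    | [] => rfl
    | .zero :: l => exact (h false l rfl).elim
    | .one :: l => exact (h true l rfl).elim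
    | .pos :: l | .neg :: l | .clauseEnd :: l => rfl
  | cons b u ih => cases b <;> simp [bit, takeBits] <;> exact ih

theorem exists_eq_takeBits_append (l : List Symb) :
    ∃ l', NoBit l' ∧ l = (takeBits l).map bit ++ l' := by
  induction l with
  | nil => exact ⟨[], noBit_nil, rfl⟩
  | cons a l ih =>
    obtain ⟨l', h1, h2⟩ := ih
    cases a
    · exact ⟨l', h1, by simpa [takeBits, bit] using h2⟩
    · exact ⟨l', h1, by simpa [takeBits, bit] using h2⟩
    all_goals
      refine ⟨_, ?_, rfl⟩
      rintro (_ | _) l' h <;> simp [bit] at h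

theorem names_sgn (p : Bool) (l : List Symb) : names (sgn p :: l) = takeBits l :: names l := by
  cases p <;> rfl

theorem names_map_bit_append (u : List Bool) (l : List Symb) :
    names (u.map bit ++ l) = names l := by
  induction u with
  | nil => rfl
  | cons b u ih => cases b <;> simpa [bit, names] using ih

theorem names_literal (a : Literal) {l : List Symb} (h : NoBit l) :
    names (a.encode ++ l) = a.var :: names l := by
  rw [Literal.encode_eq, List.cons_append, names_sgn, takeBits_append _ h, names_map_bit_append]

theorem names_encode (φ : Formula) : names φ.encode = φ.literals.map Literal.var := by
  induction φ with
  | nil => rfl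
  | cons C φ ih =>
    have e : Formula.literals (C :: φ) = C.literals ++ Formula.literals φ := rfl
    rw [Formula.encode_cons, e, List.map_append, ← ih]
    cases C with
    | single a =>
      rw [Clause.encode_single, List.append_assoc, List.singleton_append,
        names_literal _ (noBit_clauseEnd _)]
      rfl
    | pair a b =>
      rw [Clause.encode_pair, List.append_assoc, List.append_assoc, List.singleton_append,
        names_literal _ (noBit_encode_append _ _), names_literal _ (noBit_clauseEnd _)]
      rfl

theorem names_sublist {l l' : List Symb} (h : l <:+ l') : (names l).Sublist (names l') := by
  induction l' with
  | nil => rw [List.suffix_nil.1 h]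
  | cons a l' ih =>
    rcases List.suffix_cons_iff.1 h with rfl | h
    · exact List.Sublist.refl _
    · refine (ih h).trans ?_
      cases a <;> simp [names]

theorem litAt_iff {x : List Symb} {p : ℕ} {a : Literal} :
    LitAt x p a ↔ ∃ l, View x p (sgn a.positive :: l) ∧ takeBits l = a.var := by
  constructor
  · rintro ⟨l, h1, h2⟩
    exact ⟨_, h1, takeBits_append _ h2⟩
  · rintro ⟨l, h1, h2⟩
    obtain ⟨l', h3, h4⟩ := exists_eq_takeBits_append l
    rw [h2] at h4
    exact ⟨l', by rw [Literal.encode_eq, List.cons_append, ← h4]; exact h1, h3⟩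

/-- There are at least `k` occurrences of the variable `v` after position `p`. -/
def Many (x : List Symb) (v : List Bool) (k p : ℕ) : Prop :=
  ∃ l, View x (p + 1) l ∧ k ≤ (names l).count v

/-- This turns counting into a chain of searches to the right. The position `q` need not be the next
occurrence: later suffixes only contain fewer names, so skipping occurrences is harmless. -/
theorem many_succ_iff {x : List Symb} {v : List Bool} {k p : ℕ} :
    Many x v (k + 1) p ↔ ∃ q, p < q ∧ (∃ a, LitAt x q a ∧ a.var = v) ∧ Many x v k q := by
  constructor
  · rintro ⟨l, hl, hk⟩
    induction l generalizing p with
    | nil => simp [names] at hk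
    | cons s l ih =>
      by_cases hs : ∃ b, s = sgn b
      · obtain ⟨b, rfl⟩ := hs
        rw [names_sgn] at hk
        by_cases hv : takeBits l = v
        · refine ⟨p + 1, by omega, ⟨⟨v, b⟩, litAt_iff.2 ⟨l, hl, hv⟩, rfl⟩, l,
            (view_cons_iff.1 hl).2, ?_⟩
          rw [hv, List.count_cons_self] at hk
          omega
        · rw [List.count_cons_of_ne hv] at hk
          obtain ⟨q, h1, h2⟩ := ih (view_cons_iff.1 hl).2 hk
          exact ⟨q, by omega, h2⟩
      · have : names (s :: l) = names l := by
          cases s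
          case pos => exact (hs ⟨true, rfl⟩).elim
          case neg => exact (hs ⟨false, rfl⟩).elim
          all_goals rfl
        rw [this] at hk
        obtain ⟨q, h1, h2⟩ := ih (view_cons_iff.1 hl).2 hk
        exact ⟨q, by omega, h2⟩
  · rintro ⟨q, hpq, ⟨a, ha, rfl⟩, l', hl', hk⟩
    obtain ⟨l, h1, h2⟩ := litAt_iff.1 ha
    obtain rfl := (view_cons_iff.1 h1).2.unique hl'
    obtain ⟨m, hm⟩ := Instr.exists_view (Nat.succ_pos p) (show p + 1 ≤ x.length + 1 from
      (Nat.succ_le_of_lt hpq).trans h1.le)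
    refine ⟨m, hm, ?_⟩
    have hsuf : sgn a.positive :: l <:+ m := by
      obtain ⟨i, hi, rfl, h3⟩ := h1
      obtain ⟨j, hj, h4, rfl⟩ := hm
      rw [← h3]
      obtain ⟨d, rfl⟩ := Nat.exists_eq_add_of_le (show j ≤ i by omega)
      rw [← List.drop_drop]
      exact List.drop_suffix _ _
    refine le_trans ?_ ((names_sublist hsuf).count_le _)
    rw [names_sgn, h2, List.count_cons_self]
    omega

/-- Moving register `1` to a later occurrence of the variable at its position. -/
def NextOccurrence (x : List Symb) : (Fin 4 → ℕ) → (Fin 4 → ℕ) → Prop :=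
  Relation.Comp (fun v v' => ∃ p ≤ x.length + 1, v 1 < p ∧ v' = Function.update v 2 p)
    (Relation.Comp
      -- The vacuous `true = true` is the sign condition of `programmable_compare` for the constant
      -- relation: signs do not matter in counting.
      (fun v v' => (∃ a b, LitAt x (v 1) a ∧ LitAt x (v 2) b ∧ a.var = b.var ∧ true = true) ∧
        v' = v)
      (fun v v' => v 2 ≤ x.length + 1 ∧ v' = Function.update v 1 (v 2)))

theorem programmable_nextOccurrence : Programmable NextOccurrence :=
  (programmable_later 2 1).comp ((programmable_compare 1 2 fun _ _ => true).comp
    (programmable_assign 1 2))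

/-- Search for a variable that occurs four times. -/
def FindFour (x : List Symb) : (Fin 4 → ℕ) → (Fin 4 → ℕ) → Prop :=
  Relation.Comp (fun v v' => ∃ p ≤ x.length + 1, v' = Function.update v 1 p)
    (Relation.Comp (NextOccurrence x) (Relation.Comp (NextOccurrence x) (NextOccurrence x)))

theorem programmable_findFour : Programmable FindFour :=
  (programmable_guess 1).comp (programmable_nextOccurrence.comp
    (programmable_nextOccurrence.comp programmable_nextOccurrence))

theorem NextOccurrence.spec {x : List Symb} {v v' : Fin 4 → ℕ} (h : NextOccurrence x v v') :
    v 1 < v' 1 ∧ ∃ a b, LitAt x (v 1) a ∧ LitAt x (v' 1) b ∧ a.var = b.var := by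
  obtain ⟨_, ⟨p, -, h2, rfl⟩, _, ⟨⟨a, b, h3, h4, h5, -⟩, rfl⟩, -, rfl⟩ := h
  exact ⟨h2, a, b, h3, h4, h5⟩

theorem exists_nextOccurrence {x : List Symb} {v : Fin 4 → ℕ} {q : ℕ} {a b : Literal}
    (ha : LitAt x (v 1) a) (hb : LitAt x q b) (hab : a.var = b.var) (hq : v 1 < q) :
    ∃ v', NextOccurrence x v v' ∧ v' 1 = q :=
  ⟨_, ⟨_, ⟨q, hb.le, hq, rfl⟩, _, ⟨⟨a, b, ha, hb, hab, rfl⟩, rfl⟩, hb.le, rfl⟩, rfl⟩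

theorem exists_findFour_iff {φ : Formula} {v : Fin 4 → ℕ} :
    (∃ v', FindFour φ.encode v v') ↔ ∃ u, 3 < φ.occurrences u := by
  have many_zero : ∀ {u q a}, LitAt φ.encode q a → Many φ.encode u 0 q := by
    intro u q a h
    obtain ⟨l, h1, -⟩ := litAt_iff.1 h
    exact ⟨l, (view_cons_iff.1 h1).2, by omega⟩
  -- Position 0 is the left end marker, so the suffix after it is the whole input.
  have e : ∀ u, 3 < φ.occurrences u ↔ Many φ.encode u 4 0 := by
    intro u
    rw [Formula.occurrences, ← names_encode]
    constructor
    · intro h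
      exact ⟨_, Instr.view_one, h⟩
    · rintro ⟨l, h1, h2⟩
      rwa [h1.unique Instr.view_one] at h2
  simp only [e]
  constructor
  · rintro ⟨v₄, v₁, ⟨p, -, rfl⟩, v₂, h1, v₃, h2, h3⟩
    obtain ⟨l1, a, b, ha, hb, hab⟩ := h1.spec
    obtain ⟨l2, b', c, hb', hc, hbc⟩ := h2.spec
    obtain ⟨l3, c', d, hc', hd, hcd⟩ := h3.spec
    obtain rfl := hb.unique hb'
    obtain rfl := hc.unique hc'
    refine ⟨a.var, many_succ_iff.2 ⟨_, ?_, ⟨a, ha, rfl⟩, many_succ_iff.2 ⟨_, l1, ⟨b, hb, hab.symm⟩,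
      many_succ_iff.2 ⟨_, l2, ⟨c, hc, by rw [hab, hbc]⟩,
        many_succ_iff.2 ⟨_, l3, ⟨d, hd, by rw [hab, hbc, hcd]⟩, many_zero hd⟩⟩⟩⟩⟩
    obtain ⟨l, h, -⟩ := ha
    exact h.pos
  · rintro ⟨u, h⟩
    obtain ⟨p, -, ⟨a, ha, rfl⟩, h⟩ := many_succ_iff.1 h
    obtain ⟨q, l1, ⟨b, hb, hba⟩, h⟩ := many_succ_iff.1 h
    obtain ⟨r, l2, ⟨c, hc, hca⟩, h⟩ := many_succ_iff.1 h
    obtain ⟨s, l3, ⟨d, hd, hda⟩, -⟩ := many_succ_iff.1 h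
    have h0 : Function.update v 1 p 1 = p := rfl
    obtain ⟨v₂, h1, rfl⟩ := exists_nextOccurrence (v := Function.update v 1 p)
      (by rw [h0]; exact ha) hb hba.symm (by rw [h0]; exact l1)
    obtain ⟨v₃, h2, rfl⟩ := exists_nextOccurrence hb hc (hba.trans hca.symm) l2
    obtain ⟨v₄, h3, rfl⟩ := exists_nextOccurrence hc hd (hca.trans hda.symm) l3
    exact ⟨v₄, _, ⟨p, ha.le, rfl⟩, v₂, h1, v₃, h2, h3⟩

/-- The complement of `2SAT_3` is in `NL`. -/
theorem compl_twoSAT_mem_classNL :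
    (⟨Symb, (twoSAT 3)ᶜ⟩ : Σ A : Type, Language A) ∈ classNL := by
  -- On a string that encodes no formula the first alternative already accepts, so the other two
  -- need only be understood on encodings.
  refine ((programmable_notMem isRegular_formulaLang).or
    (programmable_findFour.or programmable_findCycle)).mem_classNL fun x => ?_
  rw [exists_or, exists_or]
  by_cases hx : x ∈ formulaLang
  · obtain ⟨φ, hφ, rfl⟩ := mem_formulaLang.1 hx
    rw [exists_findFour_iff, exists_findCycle_iff]
    have e : φ.encode ∈ twoSAT 3 ↔ φ.Satisfiable ∧ ∀ v, φ.occurrences v ≤ 3 := by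
      constructor
      · rintro ⟨ψ, -, h1, h2⟩
        obtain rfl := Formula.encode_injective h1
        exact h2
      · intro h
        exact ⟨φ, hφ, rfl, h⟩
    have e' : φ.encode ∈ (twoSAT 3)ᶜ ↔ ¬ φ.encode ∈ twoSAT 3 := Iff.rfl
    rw [e', e]
    simp only [hx, not_true_eq_false, false_and, exists_false, false_or, not_and_or, not_forall,
      not_le]
    tauto
  · constructor
    · intro _
      exact Or.inl ⟨_, hx, rfl⟩
    · rintro - ⟨φ, hφ, h, -⟩
      exact hx (mem_formulaLang.2 ⟨φ, hφ, h⟩)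

end SpaceBounded

/-! ## Deterministic machines in logarithmic space -/

namespace SpaceBounded

namespace Machine

variable {A : Type} {M : Machine A} {x : List A}

theorem ReachesIn.unique (hM : M.Deterministic) {n : ℕ} {c c' : M.Config}
    (h : M.ReachesIn x n c) (h' : M.ReachesIn x n c') : c = c' := by
  induction n generalizing c c' with
  | zero =>
    cases h
    cases h'
    rfl
  | succ n ih =>
    cases h with
    | step h ht =>
      cases h' with
      | step h' ht' =>
        obtain rfl := ih h h'
        rw [hM _ _ _ ht ht']

theorem ReachesIn.exists_of_le {n m : ℕ} {c : M.Config} (h : M.ReachesIn x n c) (hm : m ≤ n) :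
    ∃ c', M.ReachesIn x m c' := by
  induction h with
  | start => exact ⟨_, by rw [Nat.le_zero.1 hm]; exact .start⟩
  | @step n c t h ht ih =>
    rcases Nat.lt_or_ge n m with hlt | hle
    · obtain rfl : m = n + 1 := by omega
      exact ⟨_, h.step ht⟩
    · exact ih hle

theorem ReachesIn.le_of_halting (hM : M.Deterministic) {n m : ℕ} {c c' : M.Config}
    (h : M.ReachesIn x n c) (hc : M.Halting x c) (h' : M.ReachesIn x m c') : m ≤ n := by
  by_contra hlt
  obtain ⟨d, hd⟩ := h'.exists_of_le (show n + 1 ≤ m by omega)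
  cases hd with
  | step hd ht =>
    obtain rfl := h.unique hM hd
    rw [Halting] at hc
    rw [hc] at ht
    exact ht

/-- A deterministic computation continues in the same way from equal configurations. -/
theorem ReachesIn.shift (hM : M.Deterministic) {i j t : ℕ} {c d : M.Config}
    (hi : M.ReachesIn x i c) (hj : M.ReachesIn x j c) (h : M.ReachesIn x (j + t) d) :
    M.ReachesIn x (i + t) d := by
  induction t generalizing d with
  | zero =>
    obtain rfl := hj.unique hM h
    exact hi
  | succ t ih =>
    cases h with
    | step h ht => exact (ih h).step ht

/-- No configuration is repeated before a deterministic computation halts. -/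
theorem ReachesIn.le_of_eq (hM : M.Deterministic) {n i j : ℕ} {c d : M.Config}
    (h : M.ReachesIn x n d) (hd : M.Halting x d) (hi : M.ReachesIn x i c)
    (hj : M.ReachesIn x j c) (hjn : j ≤ n) : j ≤ i := by
  obtain ⟨t, rfl⟩ := Nat.exists_eq_add_of_le hjn
  have := (hi.shift hM hj h).le_of_halting hM hd h
  omega

theorem ReachesIn.inputPos_le {n : ℕ} {c : M.Config} (h : M.ReachesIn x n c) :
    c.inputPos ≤ x.length + 1 := by
  induction h with
  | start => exact Nat.zero_le _
  | @step n c t _ _ ih =>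
    show moveInput x c.inputPos t.inputMove ≤ _
    cases t.inputMove <;> simp only [moveInput] <;> omega

theorem ReachesIn.tape_eq_blank {S : ℕ} (hS : ∀ n c, M.ReachesIn x n c → ∀ i, c.pos i < S) {n : ℕ}
    {c : M.Config} (h : M.ReachesIn x n c) (i : Fin M.k) {p : ℕ} (hp : S ≤ p) :
    c.tape i p = M.blank := by
  induction h with
  | start => rfl
  | @step n c t h _ ih =>
    have := hS n c h i
    show Function.update (c.tape i) (c.pos i) (t.write i) p = _
    rw [Function.update_of_ne (by omega)]
    exact ih

/-- A deterministic machine that halts makes at most as many steps as there are configurations in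
the space that it uses. -/
theorem timeAtMost_of_pos_lt (hM : M.Deterministic) {S : ℕ}
    (hS : ∀ n c, M.ReachesIn x n c → ∀ i, c.pos i < S)
    (hx : ∃ n c, M.ReachesIn x n c ∧ M.Halting x c) :
    M.TimeAtMost x (Nat.card M.State *
      ((x.length + 2) * (((Nat.card M.Work) ^ S) ^ M.k * S ^ M.k))) := by
  obtain ⟨n, d, hn, hd⟩ := hx
  have := M.stateFinite
  have := M.workFinite
  choose c hc using fun i : Fin (n + 1) => hn.exists_of_le (Nat.lt_succ_iff.1 i.2)
  -- The configuration at time `i`, with tapes and head positions cut to `S` cells. Beyond these the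
  -- tapes are blank, so nothing is lost, and the codomain has the claimed size.
  let key : Fin (n + 1) → M.State × Fin (x.length + 2) × (Fin M.k → Fin S → M.Work) ×
      (Fin M.k → Fin S) := fun i =>
    ((c i).state, ⟨(c i).inputPos, Nat.lt_succ_of_le (hc i).inputPos_le⟩,
      fun j p => (c i).tape j p, fun j => ⟨(c i).pos j, hS _ _ (hc i) j⟩)
  have hkey : Function.Injective key := by
    intro i j hij
    have hcij : c i = c j := by
      simp only [key, Prod.mk.injEq, Fin.mk.injEq] at hij
      obtain ⟨h1, h2, h3, h4⟩ := hij
      have h5 : (c i).pos = (c j).pos := funext fun a => by simpa using congrFun h4 a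
      have h6 : (c i).tape = (c j).tape := by
        funext a p
        by_cases hp : p < S
        · exact congrFun (congrFun h3 a) ⟨p, hp⟩
        · rw [(hc i).tape_eq_blank hS a (not_lt.1 hp), (hc j).tape_eq_blank hS a (not_lt.1 hp)]
      revert h1 h2 h5 h6
      cases c i
      cases c j
      rintro rfl rfl rfl rfl
      rfl
    have hi := hc i
    rw [hcij] at hi
    exact Fin.ext (le_antisymm
      (hn.le_of_eq hM hd (hc j) hi (Nat.lt_succ_iff.1 i.2))
      (hn.le_of_eq hM hd hi (hc j) (Nat.lt_succ_iff.1 j.2)))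
  have hcard := Nat.card_le_card_of_injective key hkey
  simp only [Nat.card_prod, Nat.card_fun, Nat.card_fin] at hcard
  intro m c' hc'
  have := hn.le_of_halting hM hd hc'
  omega

/-- A deterministic machine that halts on every input and uses logarithmic space runs in polynomial
time. -/
theorem UsesLogSpace.exists_polynomial (h : M.UsesLogSpace) (hM : M.Deterministic)
    (hx : ∀ x, ∃ n c, M.ReachesIn x n c ∧ M.Halting x c) :
    ∃ p : Polynomial ℕ, ∀ x : List A, M.TimeAtMost x (p.eval x.length) := by
  obtain ⟨c, d, hc, hd, h⟩ := h
  let C := ⌈c⌉₊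
  let D := ⌈d⌉₊
  let g := Nat.card M.Work
  -- With `S` = C(log|x| + 1) + D cells, 2^S is at most (|x| + 1)^C 2^(C+D). The bounds g^S ≤
  -- (2^S)^g and S ≤ 2^S turn the number of tape contents and head positions into the power `g * M.k
  -- + M.k` of this.
  refine ⟨Polynomial.C (Nat.card M.State) * ((Polynomial.X + 2) *
    ((Polynomial.X + 1) ^ C * Polynomial.C (2 ^ (C + D))) ^ (g * M.k + M.k)), fun x => ?_⟩
  let S := C * (Nat.log 2 x.length + 1) + D
  have hlog : Real.logb 2 x.length ≤ Nat.log 2 x.length + 1 := by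
    -- On the empty input both logarithms are 0.
    rcases Nat.eq_zero_or_pos x.length with h0 | h0
    · rw [h0]
      simp
    · rw [Real.logb_le_iff_le_rpow (by norm_num) (by exact_mod_cast h0)]
      have := (Nat.lt_pow_succ_log_self (b := 2) (by norm_num) x.length).le
      exact_mod_cast this
  have hS : ∀ n e, M.ReachesIn x n e → ∀ i, e.pos i < S := by
    intro n e he i
    have h1 := h x n e he i
    have h2 : c * Real.logb 2 x.length ≤ C * (Nat.log 2 x.length + 1) :=
      (mul_le_mul_of_nonneg_left hlog hc).trans
        (mul_le_mul_of_nonneg_right (Nat.le_ceil c) (by positivity))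
    have h3 : d ≤ D := Nat.le_ceil d
    have h4 : ((e.pos i + 1 : ℕ) : ℝ) ≤ (S : ℕ) := by
      simp only [S]
      push_cast
      linarith
    exact_mod_cast h4
  have h2S : 2 ^ S ≤ (x.length + 1) ^ C * 2 ^ (C + D) := by
    have h1 : 2 ^ Nat.log 2 x.length ≤ x.length + 1 := by
      rcases Nat.eq_zero_or_pos x.length with h0 | h0
      · rw [h0]
        simp
      · exact (Nat.pow_log_le_self 2 h0.ne').trans (Nat.le_succ _)
    calc 2 ^ S = (2 ^ Nat.log 2 x.length) ^ C * 2 ^ (C + D) := by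
          rw [← pow_mul, ← pow_add]
          congr 1
          simp only [S]
          ring
      _ ≤ _ := Nat.mul_le_mul_right _ (Nat.pow_le_pow_left h1 C)
  have hconf : (g ^ S) ^ M.k * S ^ M.k ≤
      ((x.length + 1) ^ C * 2 ^ (C + D)) ^ (g * M.k + M.k) := by
    calc (g ^ S) ^ M.k * S ^ M.k ≤ ((2 ^ g) ^ S) ^ M.k * (2 ^ S) ^ M.k := by
          gcongr
          · exact Nat.lt_two_pow_self.le
          · exact Nat.lt_two_pow_self.le
      _ = (2 ^ S) ^ (g * M.k + M.k) := by
          rw [← pow_mul, ← pow_mul, ← pow_mul, ← pow_mul, ← pow_add]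
          congr 1
          ring
      _ ≤ _ := Nat.pow_le_pow_left h2S _
  intro n e he
  refine (timeAtMost_of_pos_lt hM hS (hx x) n e he).trans ?_
  simp only [Polynomial.eval_mul, Polynomial.eval_C, Polynomial.eval_add, Polynomial.eval_X,
    Polynomial.eval_pow, Polynomial.eval_one, Polynomial.eval_ofNat]
  exact Nat.mul_le_mul_left _ (Nat.mul_le_mul_left _ hconf)

/-! ### Complements -/

/-- The machine with other accepting states. -/
def withAccepting (M : Machine A) (S : Set M.State) : Machine A :=
  { M with accepting := S }

/-- The same configuration of a machine with other accepting states. -/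
def Config.cast {S T : Set M.State} (c : (M.withAccepting S).Config) : (M.withAccepting T).Config :=
  ⟨c.state, c.inputPos, c.tape, c.pos⟩

/-- Accepting states have no influence on transitions; the cast is needed because the type of
configurations mentions the machine. -/
theorem ReachesIn.cast {S T : Set M.State} {n : ℕ} {c : (M.withAccepting S).Config}
    (h : (M.withAccepting S).ReachesIn x n c) :
    (M.withAccepting T).ReachesIn x n c.cast := by
  induction h with
  | start => exact .start
  | step _ ht ih => exact ih.step ht

/-- Exchanging accepting and rejecting states of a decider. -/
theorem Decides.compl {P : Language A} (h : M.Decides P) :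
    (M.withAccepting M.acceptingᶜ).Decides Pᶜ := by
  obtain ⟨hdet, hhalt, hrec⟩ := h
  refine ⟨hdet, fun x => ?_, fun x => ?_⟩
  · obtain ⟨n, c, h1, h2⟩ := hhalt x
    exact ⟨n, _, ReachesIn.cast (S := M.accepting) (T := M.acceptingᶜ) h1, h2⟩
  · have e : x ∈ Pᶜ ↔ ¬ x ∈ P := Iff.rfl
    rw [e, ← hrec x]
    obtain ⟨n, c, h1, h2⟩ := hhalt x
    constructor
    · rintro ⟨n', c', h1', h2', h3'⟩ ⟨n'', c'', h1'', h2'', h3''⟩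
      have h1' : M.ReachesIn x n' c'.cast :=
        ReachesIn.cast (S := M.acceptingᶜ) (T := M.accepting) h1'
      -- By determinism there is only one halting configuration, which cannot be both accepting and
      -- rejecting.
      obtain rfl : n' = n'' := le_antisymm (h1''.le_of_halting hdet h2'' h1')
        (h1'.le_of_halting hdet h2' h1'')
      obtain rfl := h1'.unique hdet h1''
      exact h3' h3''
    · intro hna
      exact ⟨n, _, ReachesIn.cast (S := M.accepting) (T := M.acceptingᶜ) h1, h2,
        fun h3 => hna ⟨n, c, h1, h2, h3⟩⟩

theorem UsesLogSpace.withAccepting (h : M.UsesLogSpace) (S : Set M.State) :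
    (M.withAccepting S).UsesLogSpace := by
  obtain ⟨c, d, hc, hd, h⟩ := h
  exact ⟨c, d, hc, hd, fun x n e he i =>
    h x n _ (ReachesIn.cast (S := S) (T := M.accepting) he) i⟩

end Machine

theorem classL_compl {A : Type} {P : Language A}
    (h : (⟨A, P⟩ : Σ A : Type, Language A) ∈ classL) :
    (⟨A, Pᶜ⟩ : Σ A : Type, Language A) ∈ classL := by
  obtain ⟨hA, M, h1, h2⟩ := h
  exact ⟨hA, _, h1.compl, h2.withAccepting _⟩

/-! ### A logarithmic-space decider refutes the hypothesis -/

theorem Formula.one_le_mvbl {φ : Formula} (h : φ ≠ []) : 1 ≤ φ.mvbl := by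
  obtain ⟨C, φ, rfl⟩ := List.exists_cons_of_ne_nil h
  obtain ⟨a, ha⟩ : ∃ a, a ∈ C.literals := by
    cases C <;> exact ⟨_, List.mem_cons_self⟩
  refine Finset.card_pos.2 ⟨a.var, ?_⟩
  rw [List.mem_toFinset]
  exact List.mem_map.2 ⟨a, List.mem_flatMap.2 ⟨C, List.mem_cons_self, ha⟩, rfl⟩

theorem not_linearSpaceHypothesis_of_mem_classL
    (h : (⟨Symb, twoSAT 3⟩ : Σ A : Type, Language A) ∈ classL) : ¬ LinearSpaceHypothesis := by
  obtain ⟨-, M, hM, hlog⟩ := h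
  obtain ⟨c, d, hc, hd, hspace⟩ := id hlog
  intro hyp
  -- Any exponent in (0,1) would do, since only m^ε ≥ 1 is used. The constants are rounded up
  -- because polylogarithmic functions have natural coefficients.
  refine hyp (1 / 2) (by norm_num) (by norm_num)
    (fun n => (⌈c⌉₊ : ℝ) * Real.logb 2 n + (⌈d⌉₊ : ℝ))
    ⟨Polynomial.C ⌈c⌉₊ * Polynomial.X + Polynomial.C ⌈d⌉₊, fun n => by simp⟩
    ⟨M, hM, hlog.exists_polynomial hM.1 hM.2.1, fun φ hφ n e he i => ?_⟩
  have h0 : 0 ≤ Real.logb 2 (φ.encode.length : ℝ) := by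
    rcases Nat.eq_zero_or_pos φ.encode.length with h0 | h0
    · rw [h0]
      simp
    · exact Real.logb_nonneg (by norm_num) (by exact_mod_cast h0)
  -- Nonemptiness of the formula is essential: without variables the permitted space would be 0.
  have h1 : (1 : ℝ) ≤ (φ.mvbl : ℝ) ^ (1 / 2 : ℝ) :=
    Real.one_le_rpow (by exact_mod_cast Formula.one_le_mvbl hφ) (by norm_num)
  have h2 : c * Real.logb 2 φ.encode.length + d ≤
      (⌈c⌉₊ : ℝ) * Real.logb 2 φ.encode.length + (⌈d⌉₊ : ℝ) :=
    add_le_add (mul_le_mul_of_nonneg_right (Nat.le_ceil c) h0) (Nat.le_ceil d)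
  calc (e.pos i : ℝ) + 1 ≤ c * Real.logb 2 φ.encode.length + d := hspace _ n e he i
    _ ≤ (⌈c⌉₊ : ℝ) * Real.logb 2 φ.encode.length + (⌈d⌉₊ : ℝ) := h2
    _ ≤ _ := le_mul_of_one_le_left (by positivity) h1

end SpaceBounded

theorem theorem2 (h : SpaceBounded.LinearSpaceHypothesis) :
    SpaceBounded.classL ≠ SpaceBounded.classNL := by
  intro heq
  have h1 := SpaceBounded.compl_twoSAT_mem_classNL
  rw [← heq] at h1
  have h2 := SpaceBounded.classL_compl h1
  rw [compl_compl] at h2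
  exact SpaceBounded.not_linearSpaceHypothesis_of_mem_classL h2 h
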